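/- Let $K$ be an algebraically closed field of any characteristic, $\underline{x}=(x_1,\dots,x_n)$ indeterminates, and $P\in K[\underline{x}]$ a non-constant polynomial. Let $\ell\ge 2$ and let $Q_1,\dots,Q_\ell\in K[\underline{x}]$ be distinct monomials (of the form $x_1^{e_1}\cdots x_n^{e_n}$) of total degree $\le\deg P$. Assume: - $P,Q_1,\dots,Q_\ell$ are (jointly) relatively prime, i.e. every common divisor of all of them in $K[\underline{x}]$ is a constant; - the points $(a_1,\dots,a_n)\in\mathbb{N}^n\subset\mathbb{Q}^n$ such that $x_1^{a_1}\cdots x_n^{a_n}$ is one of $Q_1,\dots,Q_\ell$ or appears in $P$ with a non-zero coefficient do not all lie on one line; - if $K$ has characteristic $p>0$, at least one of $P,Q_1,\dots,Q_\ell$ is not a $p$-th power in $K[\underline{x}]$. Then $P+\lambda_1Q_1+\cdots+\lambda_\ell Q_\ell$, with $\lambda_1,\dots,\lambda_\ell$ independent indeterminates, is generically irreducible, that is, irreducible in $\overline{K(\lambda_1,\dots,\lambda_\ell)}[\underline{x}]$, where the bar denotes an algebraic closure. Moreover there is a non-empty Zariski open subset $U$ of $K^\ell$ such that $P+\lambda_1^*Q_1+\cdots+\lambda_\ell^*Q_\ell$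 is irreducible in $K[\underline{x}]$ for every $(\lambda_1^*,\dots,\lambda_\ell^*)\in U$. -/

import Mathlib

/-- The Newton representation of `P`, seen in `ℚⁿ`: the exponents of the monomials that appear
in `P` with a non-zero coefficient. -/
def newtonPoints {K : Type*} [Field K] {n : ℕ} (P : MvPolynomial (Fin n) K) :
    Set (Fin n → ℚ) :=
  {v | ∃ a ∈ P.support, v = fun j => (a j : ℚ)}

/-- `Q = x₁^e₁ ⋯ xₙ^eₙ` for some exponents. -/
def IsMonicMonomial {K : Type*} [Field K] {n : ℕ} (Q : MvPolynomial (Fin n) K) : Prop :=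
  ∃ e : Fin n →₀ ℕ, Q = MvPolynomial.monomial e 1

/-- `P, Q₁, …, Q_ℓ` are (jointly) relatively prime: their only common divisors are units. -/
def AreRelativelyPrime {K : Type*} [Field K] {n ℓ : ℕ} (P : MvPolynomial (Fin n) K)
    (Q : Fin ℓ → MvPolynomial (Fin n) K) : Prop :=
  ∀ D : MvPolynomial (Fin n) K, D ∣ P → (∀ i, D ∣ Q i) → IsUnit D

/-- The algebraic closure of the field `K(λ₁, …, λ_ℓ)` of rational functions. -/
abbrev GenericField (K : Type*) [Field K] (ℓ : ℕ) : Type _ :=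
  AlgebraicClosure (FractionRing (MvPolynomial (Fin ℓ) K))

/-- The indeterminate `λᵢ`, as an element of the algebraic closure of `K(λ₁, …, λ_ℓ)`. -/
noncomputable def genericParam (K : Type*) [Field K] {ℓ : ℕ} (i : Fin ℓ) : GenericField K ℓ :=
  algebraMap (FractionRing (MvPolynomial (Fin ℓ) K)) (GenericField K ℓ)
    (algebraMap (MvPolynomial (Fin ℓ) K) (FractionRing (MvPolynomial (Fin ℓ) K))
      (MvPolynomial.X i))

/-- The inclusion of the constants `K` in the algebraic closure of `K(λ₁, …, λ_ℓ)`. -/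
noncomputable def genericConst (K : Type*) [Field K] (ℓ : ℕ) : K →+* GenericField K ℓ :=
  (algebraMap (FractionRing (MvPolynomial (Fin ℓ) K)) (GenericField K ℓ)).comp
    ((algebraMap (MvPolynomial (Fin ℓ) K) (FractionRing (MvPolynomial (Fin ℓ) K))).comp
      MvPolynomial.C)

/-- `P + λ₁ Q₁ + ⋯ + λ_ℓ Q_ℓ` with indeterminate coefficients `λᵢ`. -/
noncomputable def genericMember {K : Type*} [Field K] {n ℓ : ℕ} (P : MvPolynomial (Fin n) K)
    (Q : Fin ℓ → MvPolynomial (Fin n) K) : MvPolynomial (Fin n) (GenericField K ℓ) :=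
  MvPolynomial.map (genericConst K ℓ) P +
    ∑ i, MvPolynomial.C (genericParam K i) * MvPolynomial.map (genericConst K ℓ) (Q i)

/-- `P + λ₁ Q₁ + ⋯ + λ_ℓ Q_ℓ` is irreducible over the algebraic closure of `K(λ₁, …, λ_ℓ)`. -/
def GenericallyIrreducible {K : Type*} [Field K] {n ℓ : ℕ} (P : MvPolynomial (Fin n) K)
    (Q : Fin ℓ → MvPolynomial (Fin n) K) : Prop :=
  Irreducible (genericMember P Q)

/-- `P + t₁ Q₁ + ⋯ + t_ℓ Q_ℓ` for a point `t` of `K^ℓ`. -/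
noncomputable def specialMember {K : Type*} [Field K] {n ℓ : ℕ} (P : MvPolynomial (Fin n) K)
    (Q : Fin ℓ → MvPolynomial (Fin n) K) (t : Fin ℓ → K) : MvPolynomial (Fin n) K :=
  P + ∑ i, MvPolynomial.C (t i) * Q i

/-- Zariski open subsets of `K^ℓ`: the complements of the common zero sets of families of
polynomials. -/
def IsZariskiOpen {K : Type*} [Field K] {ℓ : ℕ} (U : Set (Fin ℓ → K)) : Prop :=
  ∃ S : Set (MvPolynomial (Fin ℓ) K), Uᶜ = {t | ∀ f ∈ S, MvPolynomial.eval t f = 0}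

/-! Write F_t for the member with parameter t, and call t good when no t_i + coeff_{e_i}(P)
vanishes, so that every exponent of the family occurs in F_t. The heart of the matter is that
irreducible members are Zariski dense (`exists_eval_ne_zero_irreducible_specialMember`).

Fix two of the monomials, Q₀ and Q₁, and a good s; put u = F_s/Q₀ and v = Q₁/Q₀ in E = K(x). Some
exponent of F_s lies off the line through the exponents of Q₀ and Q₁, so a one-parameter torus fixes
v but moves u, and u, v are algebraically independent (`algebraicIndependent_div_monomial`). By
Zariski and Matsusaka, K(u + cv) is separably closed in E for all but finitely many c
(`finite_setOf_exists_isSeparable_notMem`). Moreover w = u + cv equals H/Q₀, where H = F_{s'} and s'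
is s moved along one axis.

Over k = K(w), the polynomial H - wQ₀ generates the ideal of the generic point x, by coprimality and
Gauss's lemma. As k is separably closed in E, over an algebraic closure of k this polynomial is a
power of a single irreducible, up to a unit. Some partial derivative is non-zero: some exponent of
the family is non-zero in K, since P is not constant (characteristic 0) or not everything is a p-th
power (characteristic p). Hence that power is the first one
(`irreducible_map_of_forall_isSeparable`). Bertini–Noether then specializes w to almost every
constant of K, and the results are again members of the family.

Density gives the theorem. A factorization of the generic member would specialize to almost every t
(`exists_ne_zero_forall_not_irreducible_map`), against density; and once the generic member is
irreducible, so are almost all special ones, by Bertini–Noether again. -/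

/-! ### Points of finitely generated algebras in algebraically closed fields -/

theorem exists_algHom_of_finiteType (k T L : Type*) [Field k] [CommRing T] [Nontrivial T]
    [Algebra k T] [Algebra.FiniteType k T] [Field L] [IsAlgClosed L] [Algebra k L] :
    Nonempty (T →ₐ[k] L) := by
  obtain ⟨m, hm⟩ := Ideal.exists_maximal T
  let := Ideal.Quotient.field m
  have : Module.Finite k (T ⧸ m) := finite_of_finite_type_of_isJacobsonRing k (T ⧸ m)
  have : Algebra.IsAlgebraic k (T ⧸ m) := Algebra.IsAlgebraic.of_finite k (T ⧸ m)
  have : Module.IsTorsionFree k (T ⧸ m) :=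
    Module.isTorsionFree_iff_faithfulSMul.2 inferInstance
  exact ⟨(IsAlgClosed.lift : (T ⧸ m) →ₐ[k] L).comp (Ideal.Quotient.mkₐ k m)⟩

/-- After base change to Frac R, injectivity keeps S non-zero, and the Nullstellensatz provides a
point with values in L. -/
theorem exists_ringHom_comp_algebraMap_eq {R S L : Type*} [CommRing R] [IsDomain R] [CommRing S]
    [Algebra R S] [Algebra.FiniteType R S] (hS : Function.Injective (algebraMap R S))
    [Field L] [IsAlgClosed L] (i : R →+* L) (hi : Function.Injective i) :
    ∃ ψ : S →+* L, ψ.comp (algebraMap R S) = i := by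
  let k := FractionRing R
  have hinj : Function.Injective (algebraMap k (TensorProduct R k S)) :=
    Algebra.TensorProduct.includeLeft_injective (S := R) hS
  have : Nontrivial (TensorProduct R k S) := hinj.nontrivial
  let : Algebra k L := (IsFractionRing.lift hi).toAlgebra
  obtain ⟨g⟩ := exists_algHom_of_finiteType k (TensorProduct R k S) L
  let h : S →ₐ[R] TensorProduct R k S := Algebra.TensorProduct.includeRight
  refine ⟨(g : _ →+* L).comp h.toRingHom, ?_⟩
  ext r
  have h1 : h (algebraMap R S r) = algebraMap k _ (algebraMap R k r) := by
    rw [AlgHom.commutes, ← IsScalarTower.algebraMap_apply]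
  have h2 : g (algebraMap k _ (algebraMap R k r)) = i r := by
    rw [AlgHom.commutes]
    exact IsFractionRing.lift_algebraMap hi r
  exact (congrArg g h1).trans h2

/-! ### Factorizations under specialization, and Bertini–Noether -/

namespace MvPolynomial

theorem sum_attach_monomial_coeff {σ R : Type*} [CommSemiring R] {A : MvPolynomial σ R}
    {s : Finset (σ →₀ ℕ)} (h : A.support ⊆ s) :
    ∑ m : s, monomial (m : σ →₀ ℕ) (coeff (m : σ →₀ ℕ) A) = A := by
  rw [Finset.sum_coe_sort s (fun m => monomial m (coeff m A))]
  conv_rhs => rw [A.as_sum]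
  symm
  refine Finset.sum_subset h fun m _ hm => ?_
  rw [notMem_support_iff.1 hm, monomial_zero]

/-- Solvability of `A * B = F` with prescribed supports specializes. -/
theorem exists_ne_zero_forall_mul_ne_of_support {σ R L K' : Type*} [CommRing R]
    [IsDomain R] [Field L] [IsAlgClosed L] [Field K'] (i : R →+* L) (hi : Function.Injective i)
    (F : MvPolynomial σ R) (s₁ s₂ : Finset (σ →₀ ℕ))
    (h : ¬ ∃ A B : MvPolynomial σ L, A.support ⊆ s₁ ∧ B.support ⊆ s₂ ∧ A * B = map i F) :
    ∃ f : R, f ≠ 0 ∧ ∀ φ : R →+* K', φ f ≠ 0 →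
      ¬ ∃ A B : MvPolynomial σ K', A.support ⊆ s₁ ∧ B.support ⊆ s₂ ∧ A * B = map φ F := by
  classical
  -- The variables of W are the unknown coefficients of A and B; I collects the equations that A * B
  -- = F imposes on them.
  let W := MvPolynomial (s₁ ⊕ s₂) R
  let UA : MvPolynomial σ W := ∑ m : s₁, monomial (m : σ →₀ ℕ) (X (Sum.inl m))
  let UB : MvPolynomial σ W := ∑ m : s₂, monomial (m : σ →₀ ℕ) (X (Sum.inr m))
  let D : MvPolynomial σ W := UA * UB - map C F
  let I : Ideal W := Ideal.span (Set.range fun m => coeff m D)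
  -- Either elimination leaves a non-zero constant f in I, and no solution survives where f ≠ 0, or
  -- R embeds in W/I and the system has a solution in L.
  by_cases hI : ∃ f : R, f ≠ 0 ∧ (C f : W) ∈ I
  · obtain ⟨f, hf, hfI⟩ := hI
    refine ⟨f, hf, fun φ hφ ⟨A, B, hA, hB, hAB⟩ => hφ ?_⟩
    let ψ : W →+* K' := eval₂Hom φ (Sum.elim (fun m => coeff (m : σ →₀ ℕ) A)
      (fun m => coeff (m : σ →₀ ℕ) B))
    have hψC (r : R) : ψ (C r) = φ r := eval₂Hom_C _ _ _
    have hψX (j : s₁ ⊕ s₂) : ψ (X j) = _ := eval₂Hom_X' _ _ _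
    have hψD : map ψ D = 0 := by
      have h1 : map ψ UA = A := by
        simp only [UA, map_sum, map_monomial, hψX]
        exact sum_attach_monomial_coeff hA
      have h2 : map ψ UB = B := by
        simp only [UB, map_sum, map_monomial, hψX]
        exact sum_attach_monomial_coeff hB
      have h3 : map ψ (map C F) = map φ F := by
        rw [map_map]
        congr 2
        ext r
        exact hψC r
      rw [map_sub, map_mul, h1, h2, h3, hAB, sub_self]
    have hle : I ≤ RingHom.ker ψ := by
      refine Ideal.span_le.2 ?_
      rintro _ ⟨m, rfl⟩
      have := congrArg (coeff m) hψD
      rw [coeff_map, coeff_zero] at this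
      exact this
    have := hle hfI
    rwa [RingHom.mem_ker, hψC] at this
  · exfalso
    apply h
    have hinj : Function.Injective (algebraMap R (W ⧸ I)) := by
      rw [injective_iff_map_eq_zero]
      intro r hr
      by_contra hr0
      exact hI ⟨r, hr0, Ideal.Quotient.eq_zero_iff_mem.1 hr⟩
    obtain ⟨ψ, hψ⟩ := exists_ringHom_comp_algebraMap_eq hinj i hi
    let χ : W →+* L := ψ.comp (Ideal.Quotient.mk I)
    have hχ : χ.comp C = i := by rw [← hψ]; rfl
    have hD : map χ D = 0 := by
      ext m
      rw [coeff_map, coeff_zero]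
      have : Ideal.Quotient.mk I (coeff m D) = 0 :=
        Ideal.Quotient.eq_zero_iff_mem.2 (Ideal.subset_span ⟨m, rfl⟩)
      simp [χ, this]
    refine ⟨map χ UA, map χ UB, ?_, ?_, ?_⟩
    · intro m hm
      by_contra hms
      rw [mem_support_iff, coeff_map, coeff_sum] at hm
      refine hm ?_
      rw [Finset.sum_eq_zero, map_zero]
      rintro ⟨m', hm'⟩ -
      rw [coeff_monomial, if_neg]
      rintro rfl
      exact hms hm'
    · intro m hm
      by_contra hms
      rw [mem_support_iff, coeff_map, coeff_sum] at hm
      refine hm ?_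
      rw [Finset.sum_eq_zero, map_zero]
      rintro ⟨m', hm'⟩ -
      rw [coeff_monomial, if_neg]
      rintro rfl
      exact hms hm'
    · have h3 : map χ (map C F) = map i F := by rw [map_map, hχ]
      rw [map_sub, map_mul, h3] at hD
      exact sub_eq_zero.1 hD

theorem isUnit_iff_totalDegree_eq_zero {σ k : Type*} [Field k] {A : MvPolynomial σ k}
    (hA : A ≠ 0) : IsUnit A ↔ A.totalDegree = 0 := by
  rw [isUnit_iff_totalDegree_of_isReduced]
  constructor
  · exact fun h => h.2
  · intro h
    refine ⟨?_, h⟩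
    rw [isUnit_iff_ne_zero]
    rw [totalDegree_eq_zero_iff_eq_C] at h
    intro h0
    rw [h0, C_0] at h
    exact hA h

theorem totalDegree_map_le' {σ R S : Type*} [CommSemiring R] [CommSemiring S] (φ : R →+* S)
    (F : MvPolynomial σ R) : (map φ F).totalDegree ≤ F.totalDegree :=
  Finset.sup_mono (support_map_subset φ F)

theorem exists_ne_zero_forall_totalDegree_map_eq {σ R : Type*} [CommRing R]
    (F : MvPolynomial σ R) (hF : F ≠ 0) (K' : Type*) [CommRing K'] :
    ∃ f : R, f ≠ 0 ∧ ∀ φ : R →+* K', φ f ≠ 0 →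
      map φ F ≠ 0 ∧ (map φ F).totalDegree = F.totalDegree := by
  obtain ⟨m, hm, hmd⟩ := Finset.exists_mem_eq_sup F.support (support_nonempty.2 hF)
    (fun m => m.sum fun _ e => e)
  refine ⟨coeff m F, mem_support_iff.1 hm, fun φ hφ => ?_⟩
  have hm' : m ∈ (map φ F).support := by rwa [mem_support_iff, coeff_map]
  refine ⟨fun h => by simp [h] at hm', le_antisymm (totalDegree_map_le' _ _) ?_⟩
  calc F.totalDegree = m.sum fun _ e => e := hmd
    _ ≤ _ := le_totalDegree hm'

/-- Degrees add up and units are the non-zero polynomials of degree 0. Stating the bounds with ≤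
turns reducibility into solvability with prescribed finite supports, the form that specializes. -/
theorem irreducible_iff_forall_totalDegree {σ k : Type*} [Field k] {F : MvPolynomial σ k}
    (hF : F.totalDegree ≠ 0) :
    Irreducible F ↔ ∀ d₁ < F.totalDegree, ∀ d₂ < F.totalDegree, d₁ + d₂ = F.totalDegree →
      ¬ ∃ A B : MvPolynomial σ k, A.totalDegree ≤ d₁ ∧ B.totalDegree ≤ d₂ ∧ A * B = F := by
  have hF0 : F ≠ 0 := by
    rintro rfl
    simp at hF
  have key (A B : MvPolynomial σ k) (h : A * B = F) :
      A ≠ 0 ∧ B ≠ 0 ∧ A.totalDegree + B.totalDegree = F.totalDegree := by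
    have hA : A ≠ 0 := by rintro rfl; simp at h; exact hF0 h.symm
    have hB : B ≠ 0 := by rintro rfl; simp at h; exact hF0 h.symm
    exact ⟨hA, hB, by rw [← h, totalDegree_mul_of_isDomain hA hB]⟩
  constructor
  · rintro h d₁ hd₁ d₂ hd₂ - ⟨A, B, hA, hB, hAB⟩
    obtain ⟨hA0, hB0, hd⟩ := key A B hAB
    rcases h.isUnit_or_isUnit hAB.symm with hu | hu
    · rw [isUnit_iff_totalDegree_eq_zero hA0] at hu
      lia
    · rw [isUnit_iff_totalDegree_eq_zero hB0] at hu
      lia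
  · refine fun h => ⟨fun hu => hF ((isUnit_iff_totalDegree_eq_zero hF0).1 hu), fun A B hAB => ?_⟩
    obtain ⟨hA0, hB0, hd⟩ := key A B hAB.symm
    rw [isUnit_iff_totalDegree_eq_zero hA0, isUnit_iff_totalDegree_eq_zero hB0]
    by_contra! hne
    exact h A.totalDegree (by lia) B.totalDegree (by lia) hd ⟨A, B, le_rfl, le_rfl, hAB.symm⟩

/-- **Bertini–Noether**: irreducibility over an algebraically closed field is inherited by almost
all specializations. -/
theorem exists_ne_zero_forall_irreducible_map {σ R L : Type*} [Finite σ] [CommRing R]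
    [IsDomain R] [Field L] [IsAlgClosed L] (i : R →+* L) (hi : Function.Injective i)
    (F : MvPolynomial σ R) (h : Irreducible (map i F)) (K' : Type*) [Field K'] :
    ∃ f : R, f ≠ 0 ∧ ∀ φ : R →+* K', φ f ≠ 0 → Irreducible (map φ F) := by
  classical
  have hF0 : F ≠ 0 := by
    rintro rfl
    simp at h
  -- Where f₀ ≠ 0 the total degree does not drop, so a proper factorization has one of the finitely
  -- many degree splittings treated below.
  obtain ⟨f₀, hf₀, H₀⟩ := exists_ne_zero_forall_totalDegree_map_eq F hF0 K'
  have hdegL : (map i F).totalDegree = F.totalDegree := by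
    unfold totalDegree
    rw [support_map_of_injective F hi]
  have hpos : F.totalDegree ≠ 0 := by
    rw [← hdegL, ne_eq, ← isUnit_iff_totalDegree_eq_zero h.ne_zero]
    exact h.not_isUnit
  let s (d : ℕ) : Finset (σ →₀ ℕ) := (Finsupp.finite_of_degree_le d).toFinset
  have hsL (A : MvPolynomial σ L) (d : ℕ) : A.support ⊆ s d ↔ A.totalDegree ≤ d := by
    simp only [s, Finset.subset_iff, Set.Finite.mem_toFinset, totalDegree, Finset.sup_le_iff]
    rfl
  have hsK (A : MvPolynomial σ K') (d : ℕ) : A.support ⊆ s d ↔ A.totalDegree ≤ d := by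
    simp only [s, Finset.subset_iff, Set.Finite.mem_toFinset, totalDegree, Finset.sup_le_iff]
    rfl
  have hirr := (irreducible_iff_forall_totalDegree (hdegL ▸ hpos)).1 h
  rw [hdegL] at hirr
  have H (d : ℕ) : ∃ f : R, f ≠ 0 ∧ ∀ φ : R →+* K', φ f ≠ 0 → 0 < d → d < F.totalDegree →
      ¬ ∃ A B : MvPolynomial σ K', A.totalDegree ≤ d ∧ B.totalDegree ≤ F.totalDegree - d ∧
        A * B = map φ F := by
    by_cases hd : 0 < d ∧ d < F.totalDegree
    · have := exists_ne_zero_forall_mul_ne_of_support (K' := K') i hi F (s d)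
        (s (F.totalDegree - d))
        (by simpa only [hsL] using hirr d hd.2 (F.totalDegree - d) (by lia) (by lia))
      simp only [hsK] at this
      obtain ⟨f, hf, hf'⟩ := this
      exact ⟨f, hf, fun φ hφ _ _ => hf' φ hφ⟩
    · exact ⟨1, one_ne_zero, fun _ _ h1 h2 => absurd ⟨h1, h2⟩ hd⟩
  choose f hf hf' using H
  refine ⟨f₀ * ∏ d ∈ Finset.range F.totalDegree, f d,
    mul_ne_zero hf₀ (Finset.prod_ne_zero_iff.2 fun d _ => hf d), fun φ hφ => ?_⟩
  rw [map_mul, map_prod] at hφ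
  obtain ⟨-, hdeg⟩ := H₀ φ (left_ne_zero_of_mul hφ)
  rw [irreducible_iff_forall_totalDegree (hdeg ▸ hpos), hdeg]
  intro d₁ hd₁ d₂ hd₂ hd
  obtain rfl : d₂ = F.totalDegree - d₁ := by lia
  exact hf' d₁ φ (Finset.prod_ne_zero_iff.1 (right_ne_zero_of_mul hφ) d₁ (Finset.mem_range.2 hd₁))
    (by lia) hd₁

end MvPolynomial

/-! ### Reducibility under specialization -/

/-- Lying over gives a prime Q of O above ker ev. The quotient O/Q is a domain integral over the
algebraically closed K, hence equal to K. -/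
theorem exists_ringHom_comp_algebraMap_eq_of_isIntegral {R O K : Type*} [CommRing R] [CommRing O]
    [IsDomain O] [Algebra R O] [Algebra.IsIntegral R O]
    (hinj : Function.Injective (algebraMap R O)) [Field K] [IsAlgClosed K]
    (ev : R →+* K) (s : K →+* R) (hs : ev.comp s = RingHom.id K) :
    ∃ ψ : O →+* K, ψ.comp (algebraMap R O) = ev := by
  have := RingHom.ker_isPrime ev
  obtain ⟨Q, hQ, hQc⟩ := Ideal.exists_ideal_over_prime_of_isIntegral_of_isDomain (S := O)
    (RingHom.ker ev) (by rw [(RingHom.injective_iff_ker_eq_bot _).1 hinj]; exact bot_le)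
  let π : O →+* O ⧸ Q := Ideal.Quotient.mk Q
  let g : K →+* O ⧸ Q := (π.comp (algebraMap R O)).comp s
  have hg : g.comp ev = π.comp (algebraMap R O) := by
    ext r
    change π (algebraMap R O (s (ev r))) = π (algebraMap R O r)
    rw [← sub_eq_zero, ← map_sub, ← map_sub]
    refine Ideal.Quotient.eq_zero_iff_mem.2 ?_
    rw [← Ideal.mem_comap, hQc, RingHom.mem_ker, map_sub, sub_eq_zero]
    exact RingHom.congr_fun hs (ev r)
  have hint : (g.comp ev).IsIntegral := by
    rw [hg]
    exact RingHom.IsIntegral.trans _ _ (algebraMap_isIntegral_iff.2 inferInstance)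
      (RingHom.isIntegral_of_surjective π Ideal.Quotient.mk_surjective)
  have hint' : g.IsIntegral := RingHom.IsIntegral.tower_top _ _ hint
  let := g.toAlgebra
  have : Algebra.IsIntegral K (O ⧸ Q) := ⟨hint'⟩
  have hbij : Function.Bijective g := IsAlgClosed.algebraMap_bijective_of_isIntegral (k := K)
  let e := RingEquiv.ofBijective g hbij
  refine ⟨(e.symm : O ⧸ Q →+* K).comp π, ?_⟩
  ext r
  have : π (algebraMap R O r) = e (ev r) := (RingHom.congr_fun hg r).symm
  simp [this]

namespace MvPolynomial

theorem exists_map_integralClosure_eq {R L σ : Type*} [CommRing R] [IsDomain R] [Field L]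
    [Algebra R L] [Algebra.IsAlgebraic R L] (A : MvPolynomial σ L) :
    ∃ r : R, r ≠ 0 ∧ ∃ A' : MvPolynomial σ (integralClosure R L),
      map (algebraMap (integralClosure R L) L) A' = C (algebraMap R L r) * A := by
  classical
  obtain ⟨r, hr, h⟩ := Algebra.IsAlgebraic.exists_integral_multiples R
    (A.support.image fun m => coeff m A)
  refine ⟨r, hr, ?_⟩
  change _ ∈ Set.range _
  rw [mem_range_map_iff_coeffs_subset]
  intro c hc
  obtain ⟨m, hm, rfl⟩ := mem_coeffs_iff.1 hc
  rw [coeff_C_mul, ← Algebra.smul_def]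
  refine ⟨⟨r • coeff m A, h _ (Finset.mem_image_of_mem _ ?_)⟩, rfl⟩
  rw [mem_support_iff, coeff_C_mul] at hm
  exact mem_support_iff.2 (right_ne_zero_of_mul hm)

/-- Reducibility over an algebraic extension of `K(t)` is inherited by almost all
specializations. -/
theorem exists_ne_zero_forall_not_irreducible_map {τ σ K L : Type*} [Field K] [IsAlgClosed K]
    [Field L] [Algebra (MvPolynomial τ K) L] [Algebra.IsAlgebraic (MvPolynomial τ K) L]
    (hinj : Function.Injective (algebraMap (MvPolynomial τ K) L))
    (F : MvPolynomial σ (MvPolynomial τ K)) (hF : F.totalDegree ≠ 0)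
    (h : ¬ Irreducible (map (algebraMap (MvPolynomial τ K) L) F)) :
    ∃ f : MvPolynomial τ K, f ≠ 0 ∧ ∀ t : τ → K, eval t f ≠ 0 → ¬ Irreducible (map (eval t) F) := by
  have hF0 : F ≠ 0 := by
    rintro rfl
    simp at hF
  obtain ⟨f₀, hf₀, H₀⟩ := exists_ne_zero_forall_totalDegree_map_eq F hF0 K
  let R := MvPolynomial τ K
  let O := integralClosure R L
  have hO : Function.Injective (algebraMap O L) := Subtype.val_injective
  have hRO : Function.Injective (algebraMap R O) := by
    intro a b hab
    refine hinj ?_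
    rw [IsScalarTower.algebraMap_apply R O L, hab, ← IsScalarTower.algebraMap_apply R O L]
  have hdegL : (map (algebraMap R L) F).totalDegree = F.totalDegree := by
    unfold totalDegree
    rw [support_map_of_injective F hinj]
  rw [irreducible_iff_forall_totalDegree (hdegL ▸ hF), hdegL] at h
  push Not at h
  obtain ⟨d₁, hd₁, d₂, hd₂, hd, A, B, hA, hB, hAB⟩ := h
  -- Clearing denominators moves the factorization into the integral closure O, where evaluation at
  -- any point t extends; r and s must then stay non-zero at t.
  obtain ⟨r, hr, A', hA'⟩ := exists_map_integralClosure_eq (R := R) A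
  obtain ⟨s, hs, B', hB'⟩ := exists_map_integralClosure_eq (R := R) B
  have hmul : A' * B' = C (algebraMap R O (r * s)) * map (algebraMap R O) F := by
    refine map_injective _ hO ?_
    simp only [map_mul, map_map, map_C]
    rw [← IsScalarTower.algebraMap_eq R O L, hA', hB', ← hAB,
      ← IsScalarTower.algebraMap_apply, ← IsScalarTower.algebraMap_apply]
    ring
  have hdeg (A : MvPolynomial σ L) (A' : MvPolynomial σ O) (r : R)
      (h : map (algebraMap O L) A' = C (algebraMap R L r) * A) :
      A'.totalDegree ≤ A.totalDegree := by
    have : (map (algebraMap O L) A').totalDegree = A'.totalDegree := by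
      unfold totalDegree
      rw [support_map_of_injective A' hO]
    rw [← this, h]
    refine (totalDegree_mul _ _).trans ?_
    simp
  refine ⟨f₀ * (r * s), mul_ne_zero hf₀ (mul_ne_zero hr hs), fun t ht => ?_⟩
  rw [map_mul] at ht
  obtain ⟨-, hdegt⟩ := H₀ (eval t) (left_ne_zero_of_mul ht)
  obtain ⟨ψ, hψ⟩ := exists_ringHom_comp_algebraMap_eq_of_isIntegral hRO (eval t) C
    (RingHom.ext fun x => eval_C x)
  have hψ' (r : R) : ψ (algebraMap R O r) = eval t r := RingHom.congr_fun hψ r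
  have hmul' := congrArg (map ψ) hmul
  rw [map_mul, map_mul, map_map, map_C, hψ, hψ', map_mul] at hmul'
  have hc := right_ne_zero_of_mul ht
  rw [map_mul] at hc
  rw [irreducible_iff_forall_totalDegree (hdegt ▸ hF), hdegt]
  push Not
  refine ⟨d₁, hd₁, d₂, hd₂, hd, C (eval t r * eval t s)⁻¹ * map ψ A', map ψ B', ?_, ?_, ?_⟩
  · refine (totalDegree_mul _ _).trans ?_
    rw [totalDegree_C, zero_add]
    exact (totalDegree_map_le' _ _).trans ((hdeg A A' r hA').trans hA)
  · exact (totalDegree_map_le' _ _).trans ((hdeg B B' s hB').trans hB)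
  · rw [mul_assoc, hmul', ← mul_assoc, ← C_mul, inv_mul_cancel₀ hc, C_1, one_mul]

end MvPolynomial

/-! ### Absolute irreducibility from a separably closed base -/

open Polynomial in
/-- If `k` is separably closed in `E`, then a separable minimal polynomial over `k` stays
minimal over `E`. -/
theorem natDegree_minpoly_eq_of_forall_isSeparable {k E Ω : Type*} [Field k] [Field E] [Algebra k E]
    [Field Ω] [IsAlgClosed Ω] [Algebra k Ω] [Algebra E Ω] [IsScalarTower k E Ω]
    (hsep : ∀ θ : E, IsSeparable k θ → θ ∈ (algebraMap k E).range)
    (α : Ω) (hα : IsSeparable k α) :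
    (minpoly k α).natDegree ≤ (minpoly E α).natDegree := by
  have hint : IsIntegral k α := hα.isIntegral
  have hintE : IsIntegral E α := hint.tower_top
  have hmonic := minpoly.monic hintE
  have hdvd : (minpoly E α).map (algebraMap E Ω) ∣ (minpoly k α).map (algebraMap k Ω) := by
    rw [IsScalarTower.algebraMap_eq k E Ω, ← Polynomial.map_map]
    exact Polynomial.map_dvd _ (minpoly.dvd_map_of_isScalarTower k E α)
  -- The roots are conjugates of α, so they are separable over k, and so are the coefficients built
  -- from them; these also lie in E, hence in k.
  have hroots : ∀ β ∈ ((minpoly E α).map (algebraMap E Ω)).roots, β ∈ separableClosure k Ω := by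
    intro β hβ
    have hβ' := (mem_roots'.1 hβ).2.dvd hdvd
    rw [IsRoot.def, eval_map_algebraMap] at hβ'
    rw [mem_separableClosure_iff]
    exact hα.of_dvd (minpoly.dvd k β hβ')
  have hlift : (minpoly E α).map (algebraMap E Ω) ∈
      (mapRingHom (algebraMap (separableClosure k Ω) Ω)).range := by
    rw [(IsAlgClosed.splits ((minpoly E α).map (algebraMap E Ω))).eq_prod_roots,
      (hmonic.map _).leadingCoeff, C_1, one_mul]
    refine Subring.multiset_prod_mem _ _ fun p hp => ?_
    obtain ⟨β, hβ, rfl⟩ := Multiset.mem_map.1 hp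
    exact ⟨X - C ⟨β, hroots β hβ⟩, by simp⟩
  obtain ⟨g, hg⟩ := hlift
  have hcoeff (i : ℕ) : (minpoly E α).coeff i ∈ (algebraMap k E).range := by
    refine hsep _ ?_
    have h1 : algebraMap E Ω ((minpoly E α).coeff i) ∈ separableClosure k Ω := by
      rw [← coeff_map, ← hg, coe_mapRingHom, coeff_map]
      exact (g.coeff i).2
    exact mem_separableClosure_iff.1
      ((map_mem_separableClosure_iff (IsScalarTower.toAlgHom k E Ω)).1 h1)
  obtain ⟨g₀, hg₀, hdeg, hmon⟩ := lifts_and_natDegree_eq_and_monic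
    ((lifts_iff_coeff_lifts _).2 hcoeff) hmonic
  rw [← hdeg]
  refine natDegree_le_of_dvd (minpoly.dvd k α ?_) hmon.ne_zero
  have := minpoly.aeval E α
  rwa [← hg₀, aeval_map_algebraMap] at this

namespace MvPolynomial

/-- A polynomial with coefficients in `k(α)` is a combination of powers of `α` with coefficients
in `k[X]`. -/
theorem exists_eq_sum_pow_mul_map {σ k L : Type*} [Field k] [Field L] [Algebra k L] (α : L)
    (hα : IsIntegral k α) (G : MvPolynomial σ L)
    (hG : ∀ m, coeff m G ∈ IntermediateField.adjoin k {α}) :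
    ∃ g : Fin (minpoly k α).natDegree → MvPolynomial σ k,
      G = ∑ i : Fin (minpoly k α).natDegree, C (α ^ (i : ℕ)) * map (algebraMap k L) (g i) := by
  classical
  let pb := IntermediateField.adjoin.powerBasis hα
  have hdim : pb.dim = (minpoly k α).natDegree := rfl
  have hpb (c : IntermediateField.adjoin k {α}) :
      (c : L) = ∑ i : Fin pb.dim, algebraMap k L (pb.basis.repr c i) * α ^ (i : ℕ) := by
    have h := congrArg (algebraMap (IntermediateField.adjoin k {α}) L) (pb.basis.sum_repr c)
    rw [map_sum] at h
    rw [← IntermediateField.algebraMap_apply, ← h]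
    refine Finset.sum_congr rfl fun i _ => ?_
    rw [pb.basis_eq_pow, Algebra.smul_def, map_mul, map_pow, ← IsScalarTower.algebraMap_apply]
    rfl
  refine ⟨fun i => ∑ m ∈ G.support, monomial m (pb.basis.repr ⟨coeff m G, hG m⟩ i), ?_⟩
  ext m
  have hrhs (i : Fin pb.dim) : coeff m (C (α ^ (i : ℕ)) * map (algebraMap k L)
      (∑ m ∈ G.support, monomial m (pb.basis.repr ⟨coeff m G, hG m⟩ i))) =
      algebraMap k L (pb.basis.repr ⟨coeff m G, hG m⟩ i) * α ^ (i : ℕ) := by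
    rw [coeff_C_mul, coeff_map, coeff_sum, mul_comm]
    congr 2
    simp only [coeff_monomial, Finset.sum_ite_eq', mem_support_iff]
    split_ifs with h
    · rfl
    · push Not at h
      have : (⟨coeff m G, hG m⟩ : IntermediateField.adjoin k {α}) = 0 := Subtype.ext h
      rw [this, map_zero, Finsupp.zero_apply]
  rw [coeff_sum]
  exact (hpb ⟨coeff m G, hG m⟩).trans (Finset.sum_congr rfl fun i _ => (hrhs i).symm)

/-- Every polynomial over `L` has a power whose coefficients are separable over `k`. -/
theorem exists_pow_forall_isSeparable_coeff {σ k L : Type*} [Field k] [Field L] [Algebra k L]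
    [Algebra.IsAlgebraic k L] (G : MvPolynomial σ L) :
    ∃ N ≠ 0, ∀ m, IsSeparable k (coeff m (G ^ N)) := by
  let q := ringExpChar k
  have : ExpChar k q := ringExpChar.expChar k
  have : ExpChar L q := expChar_of_injective_algebraMap (algebraMap k L).injective q
  let S := separableClosure k L
  have : ExpChar S q := expChar_of_injective_algebraMap (algebraMap k S).injective q
  -- An exponent of the form q ^ n makes the power map additive, so it is enough to treat constants
  -- and variables.
  suffices h : ∃ n : ℕ, G ^ q ^ n ∈ (map (algebraMap S L) : MvPolynomial σ S →+* _).range by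
    obtain ⟨n, g, hg⟩ := h
    refine ⟨q ^ n, pow_ne_zero _ (expChar_pos k q).ne', fun m => ?_⟩
    rw [← hg, coeff_map]
    exact mem_separableClosure_iff.1 (coeff m g).2
  induction G using MvPolynomial.induction_on with
  | C a =>
    obtain ⟨n, s, hs⟩ := IsPurelyInseparable.pow_mem S q a
    exact ⟨n, C s, by rw [map_C, hs, C_pow]⟩
  | add f g hf hg =>
    obtain ⟨n, hn⟩ := hf
    obtain ⟨m, hm⟩ := hg
    refine ⟨n + m, ?_⟩
    rw [add_pow_expChar_pow, pow_add, pow_mul f, mul_comm, pow_mul g]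
    exact add_mem (pow_mem hn _) (pow_mem hm _)
  | mul_X f i hf =>
    obtain ⟨n, g, hg⟩ := hf
    exact ⟨n, g * X i ^ q ^ n, by rw [map_mul, hg, map_pow, map_X, mul_pow]⟩

theorem _root_.IntermediateField.exists_isSeparable_adjoin_eq {k L : Type*} [Field k] [Field L]
    [Algebra k L] {s : Set L} (hs : s.Finite) (hsep : ∀ a ∈ s, IsSeparable k a) :
    ∃ α : L, IsSeparable k α ∧ IntermediateField.adjoin k s = IntermediateField.adjoin k {α} := by
  let M := IntermediateField.adjoin k s
  have : Finite s := hs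
  have : FiniteDimensional k M :=
    IntermediateField.finiteDimensional_adjoin fun a ha => (hsep a ha).isIntegral
  have : Algebra.IsSeparable k M := (IntermediateField.isSeparable_adjoin_iff_isSeparable k L).2 hsep
  obtain ⟨α, hα⟩ := Field.exists_primitive_element k M
  refine ⟨α, (Algebra.IsSeparable.isSeparable k α).map M.val (RingHom.injective _), ?_⟩
  have := congrArg IntermediateField.lift hα
  rw [IntermediateField.lift_adjoin_simple, IntermediateField.lift_top] at this
  exact this.symm

/-- A power of G has separable coefficients, all in some k(α), and so reads ∑ αⁱ gᵢ with gᵢ over k.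
Since the minimal polynomial of α keeps its degree over E, the powers of α are independent over E;
each gᵢ then vanishes at x and is divisible by F. -/
theorem dvd_pow_of_eval₂_eq_zero {σ k E L Ω : Type*} [Field k] [Field E] [Algebra k E]
    [Field L] [Algebra k L] [Algebra.IsAlgebraic k L] [Field Ω] [IsAlgClosed Ω]
    [Algebra k Ω] [Algebra E Ω] [IsScalarTower k E Ω] (j : L →ₐ[k] Ω)
    (hsep : ∀ θ : E, IsSeparable k θ → θ ∈ (algebraMap k E).range)
    (x : σ → E) (F : MvPolynomial σ k) (hF : ∀ G : MvPolynomial σ k, aeval x G = 0 → F ∣ G)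
    (G : MvPolynomial σ L) (hG : eval₂ (j : L →+* Ω) (fun i => algebraMap E Ω (x i)) G = 0) :
    ∃ N, map (algebraMap k L) F ∣ G ^ N := by
  obtain ⟨N, hN0, hN⟩ := exists_pow_forall_isSeparable_coeff (k := k) G
  refine ⟨N, ?_⟩
  let s : Set L := Set.range fun m : (G ^ N).support => coeff (m : σ →₀ ℕ) (G ^ N)
  obtain ⟨α, hα, hsα⟩ := IntermediateField.exists_isSeparable_adjoin_eq (k := k) (s := s)
    (Set.finite_range _) (by rintro _ ⟨m, rfl⟩; exact hN m)
  have hcoeff (m : σ →₀ ℕ) : coeff m (G ^ N) ∈ IntermediateField.adjoin k {α} := by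
    by_cases hm : m ∈ (G ^ N).support
    · rw [← hsα]
      exact IntermediateField.subset_adjoin k s ⟨⟨m, hm⟩, rfl⟩
    · rw [notMem_support_iff.1 hm]
      exact zero_mem _
  obtain ⟨g, hg⟩ := exists_eq_sum_pow_mul_map α hα.isIntegral (G ^ N) hcoeff
  have hmin : minpoly k (j α) = minpoly k α := minpoly.algHom_eq j j.injective α
  have hjα : IsSeparable k (j α) := by
    rw [IsSeparable, hmin]
    exact hα
  have hle := natDegree_minpoly_eq_of_forall_isSeparable hsep (j α) hjα
  rw [hmin] at hle
  have hind := (linearIndependent_pow (K := E) (j α)).comp (Fin.castLE hle)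
    (Fin.castLE_injective hle)
  have heval : ∑ i, aeval x (g i) • (j α) ^ (i : ℕ) = 0 := by
    have h0 : eval₂ (j : L →+* Ω) (fun i => algebraMap E Ω (x i)) (G ^ N) = 0 := by
      rw [eval₂_pow, hG, zero_pow hN0]
    rw [hg, eval₂_sum] at h0
    rw [← h0]
    refine Finset.sum_congr rfl fun i _ => ?_
    have hcomp : (j : L →+* Ω).comp (algebraMap k L) = (algebraMap E Ω).comp (algebraMap k E) := by
      rw [← IsScalarTower.algebraMap_eq]
      exact j.comp_algebraMap
    rw [eval₂_mul, eval₂_C, eval₂_map, hcomp, Algebra.smul_def, mul_comm, map_pow]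
    congr 1
    rw [aeval_def, ← coe_eval₂Hom, ← coe_eval₂Hom, ← RingHom.comp_apply, comp_eval₂Hom]
  rw [hg]
  refine Finset.dvd_sum fun i _ => Dvd.dvd.mul_left (map_dvd _ (hF _ ?_)) _
  exact Fintype.linearIndependent_iff.1 hind (fun i => aeval x (g i)) heval i

theorem totalDegree_pderiv_lt {σ R : Type*} [CommSemiring R] {F : MvPolynomial σ R} {i : σ}
    (h : pderiv i F ≠ 0) : (pderiv i F).totalDegree < F.totalDegree := by
  classical
  have key (m : σ →₀ ℕ) (hm : m ∈ (pderiv i F).support) :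
      (m.sum fun _ e => e) < F.totalDegree := by
    rw [mem_support_iff, coeff_pderiv] at hm
    refine lt_of_lt_of_le ?_ (le_totalDegree (mem_support_iff.2 (left_ne_zero_of_mul hm)))
    rw [Finsupp.sum_add_index' (fun _ => rfl) (fun _ _ _ => rfl), Finsupp.sum_single_index rfl]
    lia
  obtain ⟨m, hm⟩ := support_nonempty.2 h
  exact (Finset.sup_lt_iff (by rw [Nat.bot_eq_zero]; exact (Nat.zero_le _).trans_lt (key m hm))).2 key

/-- A polynomial `F` over `k` with a generic zero `x` in an extension `E` in which `k` is
separably closed is absolutely irreducible, provided one of its derivatives does not vanish. -/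
theorem irreducible_map_of_forall_isSeparable {σ k E L : Type*} [Field k] [Field E] [Algebra k E]
    [Field L] [Algebra k L] [Algebra.IsAlgebraic k L]
    (hsep : ∀ θ : E, IsSeparable k θ → θ ∈ (algebraMap k E).range)
    (x : σ → E) (F : MvPolynomial σ k) (hF0 : aeval x F = 0)
    (hF : ∀ G : MvPolynomial σ k, aeval x G = 0 → F ∣ G) (i : σ) (hi : pderiv i F ≠ 0) :
    Irreducible (map (algebraMap k L) F) := by
  let Ω := AlgebraicClosure E
  let j : L →ₐ[k] Ω := IsAlgClosed.lift
  let ev : MvPolynomial σ L →+* Ω := eval₂Hom (j : L →+* Ω) (fun i => algebraMap E Ω (x i))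
  have hcomp : (j : L →+* Ω).comp (algebraMap k L) = (algebraMap E Ω).comp (algebraMap k E) := by
    rw [← IsScalarTower.algebraMap_eq]
    exact j.comp_algebraMap
  have hev (G : MvPolynomial σ k) : ev (map (algebraMap k L) G) = algebraMap E Ω (aeval x G) := by
    rw [aeval_def, ← coe_eval₂Hom, ← RingHom.comp_apply (algebraMap E Ω), comp_eval₂Hom, ← hcomp]
    exact eval₂_map _ _ _ _
  have hFne : F ≠ 0 := by
    rintro rfl
    simp at hi
  have hnd : ¬ F ∣ pderiv i F := by
    rintro ⟨q, hq⟩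
    have hq0 : q ≠ 0 := by
      rintro rfl
      exact hi (by rw [hq, mul_zero])
    have := totalDegree_pderiv_lt hi
    rw [hq, totalDegree_mul_of_isDomain hFne hq0] at this
    lia
  have hdpow := dvd_pow_of_eval₂_eq_zero j hsep x F hF
  set FL := map (algebraMap k L) F with hFL
  have hFL0 : FL ≠ 0 := (map_ne_zero_iff _ (map_injective _ (algebraMap k L).injective)).2 hFne
  have hevF : ev FL = 0 := by rw [hev, hF0, map_zero]
  -- Some irreducible factor A vanishes at the generic point; then F divides a power of A, and is
  -- itself a power of A up to a unit.
  obtain ⟨A, hA, hAF, hAev⟩ : ∃ A, Irreducible A ∧ A ∣ FL ∧ ev A = 0 := by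
    obtain ⟨u, hu⟩ := UniqueFactorizationMonoid.factors_prod hFL0
    have h0 : ev (UniqueFactorizationMonoid.factors FL).prod = 0 := by
      have := congrArg ev hu
      rw [map_mul, hevF] at this
      exact (mul_eq_zero.1 this).resolve_right (u.isUnit.map ev).ne_zero
    rw [map_multiset_prod, Multiset.prod_eq_zero_iff] at h0
    obtain ⟨A, hA, hA0⟩ := Multiset.mem_map.1 h0
    exact ⟨A, UniqueFactorizationMonoid.irreducible_of_factor A hA,
      UniqueFactorizationMonoid.dvd_of_mem_factors hA, hA0⟩
  obtain ⟨N, hN⟩ := hdpow A hAev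
  obtain ⟨e, -, he⟩ := (dvd_prime_pow hA.prime N).1 hN
  rcases Nat.lt_or_ge e 2 with h2 | h2
  · interval_cases e
    · exfalso
      rw [pow_zero] at he
      exact hA.not_isUnit (isUnit_of_dvd_unit hAF (associated_one_iff_isUnit.1 he))
    · rw [pow_one] at he
      exact he.symm.irreducible hA
  -- A repeated factor makes the derivative vanish at x, so F would divide its own derivative, which
  -- is non-zero of smaller degree.
  · exfalso
    obtain ⟨B, hB⟩ := (pow_dvd_pow A h2).trans he.symm.dvd
    have hder : ev (pderiv i FL) = 0 := by
      rw [hB, pow_two, Derivation.leibniz, Derivation.leibniz]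
      simp [hAev]
    rw [hFL, pderiv_map, hev] at hder
    exact hnd (hF _ ((map_eq_zero_iff _ (algebraMap E Ω).injective).1 hder))

end MvPolynomial

/-! ### Algebraic closedness of K(T) in M(T) -/

namespace Polynomial

theorem exists_forall_eval_eq_of_linearMap {K M : Type*} [Field K] [Field M] [Algebra K M]
    (ψ : M →ₗ[K] K) (a : M[X]) :
    ∃ a' : K[X], (∀ i, a'.coeff i = ψ (a.coeff i)) ∧
      ∀ s : K, a'.eval s = ψ (a.eval (algebraMap K M s)) := by
  refine ⟨∑ i ∈ Finset.range (a.natDegree + 1), monomial i (ψ (a.coeff i)), fun i => ?_,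
    fun s => ?_⟩
  · simp only [finsetSum_coeff, coeff_monomial, Finset.sum_ite_eq', Finset.mem_range]
    split_ifs with h
    · rfl
    · rw [coeff_eq_zero_of_natDegree_lt (by lia), map_zero]
  · rw [eval_finsetSum, eval_eq_sum_range, map_sum]
    refine Finset.sum_congr rfl fun i _ => ?_
    rw [eval_monomial, ← map_pow, mul_comm (a.coeff i), ← Algebra.smul_def, map_smul,
      smul_eq_mul, mul_comm]

/-- A rational function over `M` that takes values in the infinite subfield `K` at infinitely many
points of `K` is defined over `K`. -/
theorem exists_mul_map_eq_mul_map {K M : Type*} [Field K] [Field M] [Algebra K M]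
    (a b : M[X]) (hb : b ≠ 0) (S : Set K) (hS : S.Infinite)
    (h : ∀ s ∈ S, ∃ r : K, a.eval (algebraMap K M s) = algebraMap K M r *
      b.eval (algebraMap K M s)) :
    ∃ a' b' : K[X], b' ≠ 0 ∧ b'.map (algebraMap K M) * a = a'.map (algebraMap K M) * b := by
  -- A K-linear functional, applied to coefficients, commutes with evaluation at points of K and
  -- carries a(s) = r b(s) to the same relation over K; it is chosen so that b does not become zero.
  obtain ⟨ψ, hψ⟩ : ∃ ψ : Module.Dual K M, ψ b.leadingCoeff ≠ 0 := by
    by_contra! h0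
    exact hb (leadingCoeff_eq_zero.1 ((Module.forall_dual_apply_eq_zero_iff K _).1 h0))
  obtain ⟨a', -, ha⟩ := exists_forall_eval_eq_of_linearMap ψ a
  obtain ⟨b', hb'c, hb'⟩ := exists_forall_eval_eq_of_linearMap ψ b
  refine ⟨a', b', fun h0 => hψ ?_, ?_⟩
  · rw [leadingCoeff, ← hb'c, h0, coeff_zero]
  · refine eq_of_infinite_eval_eq _ _
      ((hS.image (algebraMap K M).injective.injOn).mono ?_)
    rintro _ ⟨s, hs, rfl⟩
    obtain ⟨r, hr⟩ := h s hs
    have h1 : a'.eval s = r * b'.eval s := by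
      rw [ha, hb', hr, ← Algebra.smul_def, map_smul, smul_eq_mul]
    change eval _ _ = eval _ _
    rw [eval_mul, eval_mul, eval_map_algebraMap, eval_map_algebraMap, aeval_algebraMap_apply,
      aeval_algebraMap_apply, coe_aeval_eq_eval, h1, hr, map_mul]
    ring

end Polynomial

open Polynomial in
theorem mem_range_algebraMap_of_isAlgebraic {K M : Type*} [Field K] [IsAlgClosed K] [Field M]
    [Algebra K M] {y : M} (hy : IsAlgebraic K y) : ∃ r, algebraMap K M r = y :=
  minpoly.mem_range_of_degree_eq_one K y
    (IsAlgClosed.degree_eq_one_of_irreducible K (minpoly.irreducible hy.isIntegral))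

open Polynomial IntermediateField in
/-- If `T` is transcendental over `M ⊇ K` with `K` algebraically closed, then `K(T)` is
algebraically closed in `M(T)`. -/
theorem mem_adjoin_simple_of_isAlgebraic {K M E : Type*} [Field K] [IsAlgClosed K] [Field M]
    [Field E] [Algebra K M] [Algebra M E] [Algebra K E] [IsScalarTower K M E] {T : E}
    (hT : Transcendental M T) {θ : E} (hθM : θ ∈ M⟮T⟯) (hθ : IsAlgebraic K⟮T⟯ θ) : θ ∈ K⟮T⟯ := by
  have hTK : Transcendental K T := hT.restrictScalars (algebraMap K M).injective
  by_cases hθ0 : θ = 0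
  · rw [hθ0]
    exact zero_mem _
  obtain ⟨a, b, rfl⟩ := (mem_adjoin_simple_iff M θ).1 hθM
  have hbT : aeval T b ≠ 0 := fun h => hθ0 (by rw [h, div_zero])
  have hb : b ≠ 0 := by
    rintro rfl
    simp at hbT
  obtain ⟨q, hq0, hq⟩ := isAlgebraic_adjoin_iff.1 hθ
  let e := algEquivOfTranscendental K T hTK
  let p : K[X][X] := q.map (e.symm : _ →+* K[X])
  have hp0 : p ≠ 0 := (Polynomial.map_ne_zero_iff e.symm.injective).2 hq0
  have hpe (i : ℕ) : (q.coeff i : E) = aeval T (p.coeff i) := by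
    have h1 : q.coeff i = e (p.coeff i) := by
      rw [coeff_map]
      exact (e.apply_symm_apply _).symm
    rw [h1]
    simp [e]
  let N := p.natDegree
  have hNq : q.natDegree = N := (natDegree_map_eq_of_injective e.symm.injective q).symm
  -- The equation of θ = a(T)/b(T), cleared of denominators, is an identity in M[X] because T is
  -- transcendental over M; it may be evaluated at any s in K.
  have hident : ∑ i ∈ Finset.range (N + 1),
      (p.coeff i).map (algebraMap K M) * (a ^ i * b ^ (N - i)) = 0 := by
    refine (transcendental_iff.1 hT) _ ?_
    rw [aeval_eq_sum_range, hNq] at hq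
    have h2 : aeval T b ^ N * ∑ i ∈ Finset.range (N + 1),
        q.coeff i • (aeval T a / aeval T b) ^ i = 0 := by rw [hq, mul_zero]
    rw [← h2, map_sum, Finset.mul_sum]
    refine Finset.sum_congr rfl fun i hi => ?_
    have hiN : i ≤ N := Nat.lt_succ_iff.1 (Finset.mem_range.1 hi)
    rw [map_mul, map_mul, map_pow, map_pow, aeval_map_algebraMap, ← hpe, Algebra.smul_def, div_pow,
      ← pow_sub_mul_pow _ hiN]
    have : algebraMap (Algebra.adjoin K {T}) E (q.coeff i) = (q.coeff i : E) := rfl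
    rw [this]
    have := pow_ne_zero i hbT
    field_simp
  let S : Set K := {s | b.eval (algebraMap K M s) ≠ 0 ∧ p.leadingCoeff.eval s ≠ 0}
  have hS : S.Infinite := by
    have h1 : {s : K | b.eval (algebraMap K M s) = 0}.Finite :=
      ((b.rootSet_finite M).preimage (algebraMap K M).injective.injOn).subset fun s hs => by
        rw [Set.mem_preimage, mem_rootSet]
        exact ⟨hb, by simpa using hs⟩
    have h2 : {s : K | p.leadingCoeff.eval s = 0}.Finite :=
      (p.leadingCoeff.rootSet_finite K).subset fun s hs => by
        rw [mem_rootSet]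
        exact ⟨leadingCoeff_ne_zero.2 hp0, by simpa using hs⟩
    have := IsAlgClosed.instInfinite (K := K)
    refine (h1.union h2).infinite_compl.mono fun s hs => ?_
    rw [Set.mem_compl_iff, Set.mem_union, not_or] at hs
    exact hs
  obtain ⟨a', b', hb', hab⟩ := exists_mul_map_eq_mul_map a b hb S hS fun s hs => by
    obtain ⟨hs1, hs2⟩ := hs
    set σ := algebraMap K M s
    -- At s the value a(s)/b(s) satisfies a non-zero equation over K, so it lies in K.
    have h3 : IsAlgebraic K (a.eval σ / b.eval σ) := by
      refine ⟨p.map (evalRingHom s), fun h0 => hs2 ?_, ?_⟩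
      · have := congrArg (fun r => r.coeff N) h0
        simpa [N] using this
      · have h4 := congrArg (eval σ) hident
        rw [eval_finsetSum, eval_zero] at h4
        have h5 : b.eval σ ^ N * aeval (a.eval σ / b.eval σ) (p.map (evalRingHom s)) = 0 := by
          rw [← h4, aeval_eq_sum_range' (n := N + 1) (Nat.lt_succ_of_le natDegree_map_le),
            Finset.mul_sum]
          refine Finset.sum_congr rfl fun i hi => ?_
          have hiN : i ≤ N := Nat.lt_succ_iff.1 (Finset.mem_range.1 hi)
          have h6 : ((p.coeff i).map (algebraMap K M)).eval σ =
              algebraMap K M ((p.coeff i).eval s) := by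
            rw [eval_map_algebraMap, aeval_algebraMap_apply, coe_aeval_eq_eval]
          rw [eval_mul, eval_mul, eval_pow, eval_pow, h6, coeff_map, Algebra.smul_def, div_pow,
            ← pow_sub_mul_pow _ hiN, coe_evalRingHom]
          have := pow_ne_zero i hs1
          field_simp
        exact (mul_eq_zero.1 h5).resolve_left (pow_ne_zero _ hs1)
    obtain ⟨r, hr⟩ := mem_range_algebraMap_of_isAlgebraic h3
    exact ⟨r, by rw [hr, div_mul_cancel₀ _ hs1]⟩
  rw [mem_adjoin_simple_iff]
  refine ⟨a', b', ?_⟩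
  have hb'T : aeval T b' ≠ 0 := fun h => hb' ((transcendental_iff.1 hTK) _ h)
  have := congrArg (aeval T) hab
  rw [map_mul, map_mul, aeval_map_algebraMap, aeval_map_algebraMap] at this
  rw [div_eq_div_iff hbT hb'T, mul_comm, this]

/-! ### The Zariski–Matsusaka theorem -/

section ZariskiMatsusaka

open IntermediateField

theorem range_pair {α : Type*} (a b : α) : Set.range ![a, b] = {a, b} := by
  rw [Matrix.range_cons_cons_empty]

theorem algebraicIndependent_pair_iff {K E : Type*} [Field K] [Field E] [Algebra K E] {u v : E} :
    AlgebraicIndependent K ![u, v] ↔ Transcendental K v ∧ Transcendental K⟮v⟯ u := by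
  have h1 : ![u, v] '' {0}ᶜ = {v} := by
    ext y
    simp [Fin.exists_fin_two, eq_comm]
  have h2 : AlgebraicIndependent K (fun j : {j : Fin 2 // j ≠ 0} => ![u, v] j) ↔
      Transcendental K v := by
    have : Subsingleton {j : Fin 2 // j ≠ 0} := ⟨fun a b => by
      obtain ⟨a, ha⟩ := a
      obtain ⟨b, hb⟩ := b
      ext
      simp only
      lia⟩
    exact algebraicIndependent_singleton_iff (⟨1, by simp⟩ : {j : Fin 2 // j ≠ 0})
  rw [AlgebraicIndependent.iff_transcendental_adjoin_image 0, h2, h1, transcendental_adjoin_iff]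
  rfl

theorem IntermediateField.isAlgebraic_of_le {K E : Type*} [Field K] [Field E] [Algebra K E]
    {F₁ F₂ : IntermediateField K E} (h : F₁ ≤ F₂) {x : E} (hx : IsAlgebraic F₁ x) :
    IsAlgebraic F₂ x := by
  let := (inclusion h).toAlgebra
  have : IsScalarTower F₁ F₂ E := IsScalarTower.of_algebraMap_eq fun _ => rfl
  exact hx.tower_top F₂

theorem IntermediateField.isSeparable_of_le {K E : Type*} [Field K] [Field E] [Algebra K E]
    {F₁ F₂ : IntermediateField K E} (h : F₁ ≤ F₂) {x : E} (hx : IsSeparable F₁ x) :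
    IsSeparable F₂ x := by
  let := (inclusion h).toAlgebra
  have : IsScalarTower F₁ F₂ E := IsScalarTower.of_algebraMap_eq fun _ => rfl
  exact hx.tower_top F₂

/-- An algebraically independent pair over `K` becomes a transcendence basis over a suitable
intermediate field. -/
theorem exists_intermediateField_isAlgebraic_adjoin_pair {K E : Type*} [Field K] [Field E]
    [Algebra K E] {u v : E} (h : AlgebraicIndependent K ![u, v]) :
    ∃ k : IntermediateField K E, AlgebraicIndependent k ![u, v] ∧
      Algebra.IsAlgebraic (adjoin k {u, v}) E := by
  let F := adjoin K (Set.range ![u, v])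
  obtain ⟨s, hs⟩ := exists_isTranscendenceBasis F E
  have h1 := algebraicIndependent_adjoin_iff.1 hs.1
  -- With s a transcendence basis of E over K(u, v), the family u, v, s is independent over K;
  -- exchanging the roles of its two parts allows k = K(s).
  have h2 := AlgebraicIndependent.sumElim_iff.2 ⟨h, h1⟩
  have h3 : AlgebraicIndependent K (Sum.elim ![u, v] (Subtype.val : s → E)) := by
    have := h2.comp Sum.swap Sum.swap_leftInverse.injective
    convert this using 1
    ext (i | i) <;> rfl
  have h4 := (AlgebraicIndependent.sumElim_iff.1 h3).2
  refine ⟨adjoin K s, ?_, ⟨fun x => ?_⟩⟩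
  · rw [algebraicIndependent_adjoin_iff]
    rwa [Subtype.range_val] at h4
  · have h5 := hs.isAlgebraic_field
    have h6 : IsAlgebraic ((adjoin F (Set.range (Subtype.val : s → E))).restrictScalars K) x :=
      h5.isAlgebraic x
    refine isAlgebraic_of_le (F₂ := (adjoin (adjoin K s) {u, v}).restrictScalars K) ?_ h6
    rw [Subtype.range_val, adjoin_adjoin_comm, range_pair]

theorem adjoin_pair_add_smul_eq {K E : Type*} [Field K] [Field E] [Algebra K E] (u v : E)
    {c c' : K} (hc : c ≠ c') :
    adjoin K {u + c • v, u + c' • v} = adjoin K {u, v} := by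
  have hc' : c - c' ≠ 0 := sub_ne_zero.2 hc
  apply le_antisymm
  · rw [adjoin_le_iff]
    have hu : u ∈ adjoin K {u, v} := subset_adjoin K _ (by simp)
    have hv : v ∈ adjoin K {u, v} := subset_adjoin K _ (by simp)
    rintro _ (rfl | rfl)
    · exact add_mem hu (smul_mem _ hv)
    · exact add_mem hu (smul_mem _ hv)
  · rw [adjoin_le_iff]
    have hu : u + c • v ∈ adjoin K {u + c • v, u + c' • v} := subset_adjoin K _ (by simp)
    have hv : u + c' • v ∈ adjoin K {u + c • v, u + c' • v} := subset_adjoin K _ (by simp)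
    have hv' : v ∈ adjoin K {u + c • v, u + c' • v} := by
      have := smul_mem _ (sub_mem hu hv) (x := (c - c')⁻¹)
      rwa [add_sub_add_left_eq_sub, ← sub_smul, smul_smul, inv_mul_cancel₀ hc', one_smul] at this
    rintro _ (rfl | rfl)
    · simpa using sub_mem hu (smul_mem _ hv' (x := c))
    · exact hv'

/-- The transcendence degree is at least 2, so two elements over which E is algebraic cannot be
dependent. -/
theorem algebraicIndependent_pair_of_isAlgebraic {K E : Type*} [Field K] [Field E] [Algebra K E]
    {u v w w' : E} (h : AlgebraicIndependent K ![u, v]) (halg : Algebra.IsAlgebraic K⟮w, w'⟯ E) :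
    AlgebraicIndependent K ![w, w'] := by
  have : Algebra.IsAlgebraic (Algebra.adjoin K (Set.range ![w, w'])) E := by
    rw [range_pair]
    exact isAlgebraic_adjoin_iff_top.1 halg
  refine (Algebra.IsAlgebraic.isTranscendenceBasis_of_lift_le_trdeg_of_finite K ![w, w'] ?_).1
  exact h.lift_cardinalMk_le_trdeg

/-- Put M = k(w, θ), algebraic over k(w). Then w' is transcendental over M, and θ' is an element of
M(w') algebraic over K(w'). -/
theorem mem_adjoin_simple_of_mem_adjoin_simple {K E : Type*} [Field K] [IsAlgClosed K] [Field E]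
    [Algebra K E] (k : IntermediateField K E) {w w' θ θ' : E}
    (h : AlgebraicIndependent k ![w', w]) (hθ : IsAlgebraic K⟮w⟯ θ)
    (hθ' : IsAlgebraic K⟮w'⟯ θ') (hmem : θ' ∈ adjoin k {w, w', θ}) : θ' ∈ K⟮w'⟯ := by
  let F := adjoin k {w}
  have hθF : IsAlgebraic F θ := by
    refine isAlgebraic_of_le (F₂ := (adjoin k {w}).restrictScalars K) ?_ hθ
    rw [adjoin_le_iff]
    intro y hy
    rw [Set.mem_singleton_iff.1 hy]
    exact mem_adjoin_simple_self k w
  let M := F⟮θ⟯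
  have : Algebra.IsAlgebraic F M := isAlgebraic_adjoin_simple hθF.isIntegral
  have hT : Transcendental M w' := (algebraicIndependent_pair_iff.1 h).2.extendScalars M
  let : Algebra K M :=
    ((algebraMap F M).comp ((algebraMap k F).comp (algebraMap K k))).toAlgebra
  have : IsScalarTower K M E := IsScalarTower.of_algebraMap_eq fun _ => rfl
  refine mem_adjoin_simple_of_isAlgebraic hT ?_ hθ'
  have hle : adjoin k {w, w', θ} ≤ ((adjoin M {w'}).restrictScalars F).restrictScalars k := by
    rw [adjoin_le_iff]
    have hM (y : E) (hy : y ∈ M) : y ∈ adjoin M {w'} :=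
      IntermediateField.algebraMap_mem (adjoin M {w'}) (⟨y, hy⟩ : M)
    intro y hy
    rcases hy with hy | hy | hy <;> rw [hy]
    · exact hM _ (IntermediateField.algebraMap_mem M (⟨_, mem_adjoin_simple_self k _⟩ : F))
    · exact mem_adjoin_simple_self M _
    · exact hM _ (mem_adjoin_simple_self F _)
  exact hle hmem

/-- **Zariski, Matsusaka**: if `u` and `v` are algebraically independent, then `K(u + c v)` is
separably closed in `E` for all but finitely many `c`. -/
theorem finite_setOf_exists_isSeparable_notMem {K E : Type*} [Field K] [IsAlgClosed K] [Field E]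
    [Algebra K E] [Algebra.EssFiniteType K E] {u v : E} (h : AlgebraicIndependent K ![u, v]) :
    {c : K | ∃ θ, IsSeparable K⟮u + c • v⟯ θ ∧ θ ∉ K⟮u + c • v⟯}.Finite := by
  obtain ⟨k, hk, halg⟩ := exists_intermediateField_isAlgebraic_adjoin_pair h
  let D := adjoin k {u, v}
  have : IsScalarTower K D E := IsScalarTower.of_algebraMap_eq fun _ => rfl
  have : Algebra.EssFiniteType D E := .of_comp K D E
  have : Module.Finite D E := Algebra.finite_of_essFiniteType_of_isAlgebraic
  let N := separableClosure D E
  -- N is finite separable over D, so it has finitely many intermediate fields. Infinitely many bad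
  -- c would give two with D(θ_c) = D(θ_c').
  have hfin : Finite (IntermediateField D N) :=
    Field.finite_intermediateField_of_exists_primitive_element D N
      (Field.exists_primitive_element D N)
  by_contra hinf
  let B := {c : K | ∃ θ, IsSeparable K⟮u + c • v⟯ θ ∧ θ ∉ K⟮u + c • v⟯}
  have : Infinite B := Set.infinite_coe_iff.2 hinf
  choose θ hθs hθn using fun c : B => c.2
  have hD (c : K) : K⟮u + c • v⟯ ≤ D.restrictScalars K := by
    rw [adjoin_le_iff]
    rintro _ rfl
    exact add_mem (subset_adjoin k _ (by simp)) (smul_mem (D.restrictScalars K)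
      (show v ∈ D from subset_adjoin k _ (by simp)))
  have hθN (c : B) : θ c ∈ N :=
    mem_separableClosure_iff.2 (isSeparable_of_le (F₂ := D.restrictScalars K) (hD c) (hθs c))
  obtain ⟨c, c', hcc, heq⟩ := Finite.exists_ne_map_eq_of_infinite
    fun c : B => adjoin D {(⟨θ c, hθN c⟩ : N)}
  have hne : (c : K) ≠ c' := fun h => hcc (Subtype.ext h)
  have hmem : θ c' ∈ adjoin D {θ c} := by
    have h1 := congrArg IntermediateField.lift heq
    rw [lift_adjoin_simple, lift_adjoin_simple] at h1
    have h2 : θ c' ∈ adjoin D {θ c'} := mem_adjoin_simple_self D _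
    exact h1.symm ▸ h2
  -- Two distinct members of the pencil u + cv generate D over k, so θ_c' lies in k(w, w', θ_c).
  have hDeq : adjoin k {u + (c' : K) • v, u + (c : K) • v} = D := by
    have := adjoin_pair_add_smul_eq (K := k) u v (c := algebraMap K k c')
      (c' := algebraMap K k c) fun h => hne ((algebraMap K k).injective h).symm
    simpa only [algebraMap_smul] using this
  have hind : AlgebraicIndependent k ![u + (c' : K) • v, u + (c : K) • v] :=
    algebraicIndependent_pair_of_isAlgebraic hk (by rw [hDeq]; exact halg)
  refine hθn c' (mem_adjoin_simple_of_mem_adjoin_simple k hind (hθs c).isIntegral.isAlgebraic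
    (hθs c').isIntegral.isAlgebraic ?_)
  have hle : (adjoin D {θ c}).restrictScalars k ≤
      adjoin k {u + (c : K) • v, u + (c' : K) • v, θ c} := by
    rw [adjoin_adjoin_left, adjoin_le_iff]
    have hsub : D ≤ adjoin k {u + (c : K) • v, u + (c' : K) • v, θ c} := by
      rw [← hDeq]
      refine adjoin.mono _ _ _ ?_
      rintro _ (rfl | rfl) <;> simp
    rintro x (hx | rfl)
    · exact hsub (subset_adjoin k _ hx)
    · exact subset_adjoin k _ (by simp)
  exact hle hmem

end ZariskiMatsusaka

/-! ### Irreducibility of the general member of a pencil -/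

-- Gauss's lemma: QX - H is prime because Q and H are coprime. It divides p over the fraction field,
-- hence divides a constant multiple of p, and for degree reasons it does not divide the constant.
open Polynomial in
theorem Polynomial.dvd_of_aeval_div_eq_zero {A E : Type*} [CommRing A] [IsDomain A]
    [UniqueFactorizationMonoid A] [Field E] [Algebra A E] [IsFractionRing A E] {H Q : A}
    (hQ : Q ≠ 0) (hrel : IsRelPrime Q H) (p : A[X])
    (hp : aeval (algebraMap A E H / algebraMap A E Q) p = 0) : C Q * X + C (-H) ∣ p := by
  have hprime : Prime (C Q * X + C (-H)) :=
    (irreducible_C_mul_X_add_C hQ hrel.neg_right).prime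
  have hQE : algebraMap A E Q ≠ 0 := (map_ne_zero_iff _ (IsFractionRing.injective A E)).2 hQ
  have hmap : (C Q * X + C (-H)).map (algebraMap A E) ∣ p.map (algebraMap A E) := by
    have h1 : (C Q * X + C (-H)).map (algebraMap A E) =
        C (algebraMap A E Q) * (X - C (algebraMap A E H / algebraMap A E Q)) := by
      rw [mul_sub, ← C_mul, mul_div_cancel₀ _ hQE]
      simp [sub_eq_add_neg]
    rw [h1]
    refine (IsUnit.mul_left_dvd (isUnit_C.2 hQE.isUnit)).2 (dvd_iff_isRoot.2 ?_)
    rwa [IsRoot.def, eval_map_algebraMap]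
  obtain ⟨q, hq⟩ := hmap
  obtain ⟨d, hd, hdq⟩ := IsLocalization.integerNormalization_spec (nonZeroDivisors A) q
  set q' := IsLocalization.integerNormalization (nonZeroDivisors A) q
  have hdp : C d * p = (C Q * X + C (-H)) * q' := by
    refine map_injective _ (IsFractionRing.injective A E) ?_
    rw [Polynomial.map_mul, Polynomial.map_mul, hdq, hq, map_C, ← algebraMap_smul E d q, ← C_mul']
    ring
  rcases hprime.dvd_or_dvd (Dvd.intro _ hdp.symm) with h | h
  · exfalso
    have hd0 : d ≠ 0 := nonZeroDivisors.ne_zero hd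
    have h2 := natDegree_le_of_dvd h (C_ne_zero.2 hd0)
    rw [natDegree_C, natDegree_linear hQ] at h2
    lia
  · exact h

namespace MvPolynomial

open IntermediateField

/-- The substitution `T ↦ w` from `K[x][T]` to `K(w)[x]`. -/
noncomputable def substAdjoin (σ : Type*) {K E : Type*} [Field K] [Field E] [Algebra K E] (w : E) :
    Polynomial (MvPolynomial σ K) →+* MvPolynomial σ K⟮w⟯ :=
  Polynomial.eval₂RingHom (map (algebraMap K K⟮w⟯)) (C (AdjoinSimple.gen K w))

theorem substAdjoin_map_C {σ K E : Type*} [Field K] [Field E] [Algebra K E] (w : E)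
    (r : Polynomial K) :
    substAdjoin σ w (r.map C) = C (Polynomial.aeval (AdjoinSimple.gen K w) r) := by
  have h1 : (map (algebraMap K K⟮w⟯)).comp C =
      (C : K⟮w⟯ →+* MvPolynomial σ K⟮w⟯).comp (algebraMap K K⟮w⟯) := by
    ext; simp
  rw [substAdjoin, Polynomial.coe_eval₂RingHom, Polynomial.eval₂_map, h1, ← Polynomial.hom_eval₂]
  rfl

/-- Clearing denominators in w brings G into the image of K[x][T], where divisibility by QT - H can
be tested. -/
theorem exists_C_mul_eq_substAdjoin {σ K E : Type*} [Field K] [Field E] [Algebra K E] (w : E)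
    (G : MvPolynomial σ K⟮w⟯) : ∃ d : Polynomial K,
      Polynomial.aeval (AdjoinSimple.gen K w) d ≠ 0 ∧ ∃ p : Polynomial (MvPolynomial σ K),
      C (Polynomial.aeval (AdjoinSimple.gen K w) d) * G = substAdjoin σ w p := by
  induction G using MvPolynomial.induction_on with
  | C a =>
    obtain ⟨r, s, hrs⟩ := (mem_adjoin_simple_iff K (a : E)).1 a.2
    let γ := AdjoinSimple.gen K w
    have hval (r : Polynomial K) : algebraMap K⟮w⟯ E (Polynomial.aeval γ r) =
        Polynomial.aeval w r := by
      rw [← Polynomial.aeval_algebraMap_apply, AdjoinSimple.algebraMap_gen]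
    have ha : a = Polynomial.aeval γ r / Polynomial.aeval γ s := by
      refine (algebraMap K⟮w⟯ E).injective ?_
      rw [map_div₀, hval, hval, ← hrs]
      rfl
    by_cases hs : Polynomial.aeval γ s = 0
    · exact ⟨1, by simp, 0, by rw [ha, hs]; simp⟩
    · exact ⟨s, hs, r.map C, by rw [ha, ← C_mul, mul_div_cancel₀ _ hs, substAdjoin_map_C]⟩
  | add f g hf hg =>
    obtain ⟨d, hd, p, hp⟩ := hf
    obtain ⟨e, he, q, hq⟩ := hg
    refine ⟨d * e, by rw [map_mul]; exact mul_ne_zero hd he,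
      e.map C * p + d.map C * q, ?_⟩
    rw [map_add, map_mul (substAdjoin σ w), map_mul (substAdjoin σ w), substAdjoin_map_C,
      substAdjoin_map_C, ← hp, ← hq, map_mul, C_mul]
    ring
  | mul_X f i hf =>
    obtain ⟨d, hd, p, hp⟩ := hf
    refine ⟨d, hd, p * Polynomial.C (X i), ?_⟩
    rw [← mul_assoc, hp, map_mul]
    simp [substAdjoin]

/-- A pencil `H - t Q` over an algebraically closed field `K`, such that `K(H / Q)` is separably
closed in the field of rational functions, has irreducible general member. -/
theorem exists_ne_zero_forall_irreducible_sub_C_mul {σ K E : Type*} [Finite σ] [Field K]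
    [Field E] [Algebra K E] [Algebra (MvPolynomial σ K) E]
    [IsScalarTower K (MvPolynomial σ K) E] [IsFractionRing (MvPolynomial σ K) E]
    {H Q : MvPolynomial σ K} (hQ : Q ≠ 0) (hrel : IsRelPrime Q H) {w : E}
    (hw : w = algebraMap _ E H / algebraMap _ E Q) (htr : Transcendental K w)
    (hsep : ∀ θ : E, IsSeparable K⟮w⟯ θ → θ ∈ K⟮w⟯)
    {m : σ →₀ ℕ} {i : σ} (hmi : (m i : K) ≠ 0) (hm : coeff m H ≠ 0 ∨ coeff m Q ≠ 0) :
    ∃ f : Polynomial K, f ≠ 0 ∧ ∀ t, f.eval t ≠ 0 → Irreducible (H - C t * Q) := by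
  let k := K⟮w⟯
  let γ : k := AdjoinSimple.gen K w
  have hγ : algebraMap k E γ = w := AdjoinSimple.algebraMap_gen K w
  let F : MvPolynomial σ k := map (algebraMap K k) H - C γ * map (algebraMap K k) Q
  let x : σ → E := fun j => algebraMap (MvPolynomial σ K) E (X j)
  have hx : (aeval x : MvPolynomial σ K →ₐ[K] E) = IsScalarTower.toAlgHom K (MvPolynomial σ K) E := by
    ext j
    simp [x]
  have hQE : algebraMap _ E Q ≠ 0 :=
    (map_ne_zero_iff _ (IsFractionRing.injective (MvPolynomial σ K) E)).2 hQ
  have hxmap (G : MvPolynomial σ K) :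
      aeval x (map (algebraMap K k) G) = algebraMap (MvPolynomial σ K) E G := by
    rw [aeval_map_algebraMap, hx]
    rfl
  have hF0 : aeval x F = 0 := by
    rw [map_sub, map_mul, hxmap, hxmap, aeval_C, hγ, hw, div_mul_cancel₀ _ hQE, sub_self]
  have hsubst (p : Polynomial (MvPolynomial σ K)) :
      aeval x (substAdjoin σ w p) = Polynomial.aeval w p := by
    have : ((aeval x : MvPolynomial σ k →ₐ[k] E) : MvPolynomial σ k →+* E).comp (substAdjoin σ w) =
        (Polynomial.aeval w : Polynomial (MvPolynomial σ K) →ₐ[MvPolynomial σ K] E) := by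
      refine Polynomial.ringHom_ext (fun G => ?_) ?_
      · simpa [substAdjoin] using hxmap G
      · simp [substAdjoin]
    exact RingHom.congr_fun this p
  have hFsub : substAdjoin σ w (Polynomial.C Q * Polynomial.X + Polynomial.C (-H)) = -F := by
    simp only [substAdjoin, Polynomial.coe_eval₂RingHom, Polynomial.eval₂_add,
      Polynomial.eval₂_mul, Polynomial.eval₂_C, Polynomial.eval₂_X, F, γ, k]
    rw [map_neg]
    ring
  have hFker (G : MvPolynomial σ k) (hG : aeval x G = 0) : F ∣ G := by
    obtain ⟨d, hd, p, hp⟩ := exists_C_mul_eq_substAdjoin w G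
    have hp0 : Polynomial.aeval w p = 0 := by
      rw [← hsubst, ← hp, map_mul, hG, mul_zero]
    rw [hw] at hp0
    have h1 := map_dvd (substAdjoin σ w) (Polynomial.dvd_of_aeval_div_eq_zero hQ hrel p hp0)
    rw [hFsub, ← hp] at h1
    have h2 : F ∣ -F := ⟨-1, by ring⟩
    exact (IsUnit.dvd_mul_left ((isUnit_iff_ne_zero.2 hd).map C)).1 (h2.trans h1)
  -- The two contributions cannot cancel, since w is transcendental and so not in K.
  have hcoeff : coeff m F ≠ 0 := by
    rw [coeff_sub, coeff_C_mul, coeff_map, coeff_map]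
    intro h0
    have h1 : algebraMap K E (coeff m H) = w * algebraMap K E (coeff m Q) := by
      have := congrArg (algebraMap k E) (sub_eq_zero.1 h0)
      rwa [map_mul, hγ, ← IsScalarTower.algebraMap_apply, ← IsScalarTower.algebraMap_apply] at this
    by_cases hmQ : coeff m Q = 0
    · rw [hmQ, map_zero, mul_zero, map_eq_zero] at h1
      exact hm.elim (fun h => h h1) (fun h => h hmQ)
    · refine htr ?_
      have : w = algebraMap K E (coeff m H / coeff m Q) := by
        rw [map_div₀, h1, mul_div_cancel_right₀]
        rwa [ne_eq, map_eq_zero]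
      rw [this]
      exact isAlgebraic_algebraMap _
  have hder : pderiv i F ≠ 0 := by
    classical
    have hmi0 : m i ≠ 0 := by
      rintro h
      simp [h] at hmi
    have hle : Finsupp.single i 1 ≤ m := by
      rw [Finsupp.single_le_iff]
      lia
    intro h0
    have h1 := congrArg (coeff (m - Finsupp.single i 1)) h0
    rw [coeff_pderiv, tsub_add_cancel_of_le hle, coeff_zero, Finsupp.tsub_apply,
      Finsupp.single_eq_same] at h1
    rcases mul_eq_zero.1 h1 with h | h
    · exact hcoeff h
    · rw [← Nat.cast_succ, Nat.succ_eq_add_one, Nat.sub_add_cancel (by lia)] at h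
      refine hmi ((algebraMap K k).injective ?_)
      rw [map_natCast, h, map_zero]
  have hirr : Irreducible (map (algebraMap k (AlgebraicClosure k)) F) :=
    irreducible_map_of_forall_isSeparable (fun θ hθ => ⟨⟨θ, hsep θ hθ⟩, rfl⟩) x F hF0 hFker i hder
  have htrγ : Function.Injective (Polynomial.aeval γ : Polynomial K →ₐ[K] k) := by
    rw [← transcendental_iff_injective]
    intro h
    refine htr ?_
    rw [← hγ]
    exact h.algebraMap
  let ι : Polynomial K →+* AlgebraicClosure k :=
    (algebraMap k (AlgebraicClosure k)).comp (Polynomial.aeval γ : Polynomial K →ₐ[K] k)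
  have hι : Function.Injective ι := (algebraMap k (AlgebraicClosure k)).injective.comp htrγ
  -- The pencil over K[T]: T ↦ w recovers F over the closure of k, and T ↦ t gives the member H -
  -- tQ.
  let FR : MvPolynomial σ (Polynomial K) :=
    map Polynomial.C H - C Polynomial.X * map Polynomial.C Q
  have hFR : map ι FR = map (algebraMap k (AlgebraicClosure k)) F := by
    have h1 : ι.comp Polynomial.C = (algebraMap k (AlgebraicClosure k)).comp (algebraMap K k) := by
      ext a
      simp [ι]
    have h2 : ι Polynomial.X = algebraMap k (AlgebraicClosure k) γ := by simp [ι]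
    simp only [FR, F, map_sub, map_mul, map_map, map_C, h1, h2]
  obtain ⟨f, hf, H'⟩ := exists_ne_zero_forall_irreducible_map ι hι FR (hFR ▸ hirr) K
  refine ⟨f, hf, fun t ht => ?_⟩
  have h3 := H' (Polynomial.evalRingHom t) ht
  have h4 : (Polynomial.evalRingHom t).comp Polynomial.C = RingHom.id K := by
    ext; simp
  simpa only [FR, map_sub, map_mul, map_map, map_C, h4, map_id, Polynomial.coe_evalRingHom,
    Polynomial.eval_X, RingHom.id_apply] using h3

end MvPolynomial

/-! ### Torus actions and algebraic independence -/

namespace MvPolynomial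

open IntermediateField

section Torus

variable {σ K : Type*} [Fintype σ] [Field K]

/-- The one-parameter group of automorphisms `xᵢ ↦ s ^ φᵢ xᵢ`. -/
noncomputable def torus (φ : σ → ℤ) (s : Kˣ) : MvPolynomial σ K →ₐ[K] MvPolynomial σ K :=
  aeval fun i => C ((s ^ φ i : Kˣ) : K) * X i

theorem coeff_torus (φ : σ → ℤ) (s : Kˣ) (p : MvPolynomial σ K) (m : σ →₀ ℕ) :
    coeff m (torus φ s p) = ((s ^ ∑ i, φ i * m i : Kˣ) : K) * coeff m p := by
  classical
  induction p using MvPolynomial.induction_on' with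
  | monomial m' c =>
    have h : torus φ s (monomial m' c) = monomial m' (((s ^ ∑ i, φ i * m' i : Kˣ) : K) * c) := by
      rw [torus, aeval_monomial, Finsupp.prod_fintype _ _ (by simp)]
      have hs : ∏ i, (s ^ φ i) ^ m' i = s ^ ∑ i, φ i * m' i := by
        refine Finset.cons_induction (by simp) (fun i S hi h => ?_) Finset.univ
        rw [Finset.prod_cons, Finset.sum_cons, zpow_add, zpow_mul, zpow_natCast, h]
      rw [← hs, monomial_eq, Finsupp.prod_fintype _ _ (by simp), algebraMap_eq, C_mul,
        Units.coe_prod, map_prod]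
      simp only [mul_pow, Finset.prod_mul_distrib, Units.val_pow_eq_pow_val, C_pow]
      ring
    rw [h, coeff_monomial, coeff_monomial]
    split_ifs with h'
    · rw [h']
    · rw [mul_zero]
  | add p q hp hq => rw [map_add, coeff_add, coeff_add, hp, hq, mul_add]

theorem torus_injective (φ : σ → ℤ) (s : Kˣ) : Function.Injective (torus φ s) := by
  rw [injective_iff_map_eq_zero]
  intro p hp
  ext m
  have := congrArg (coeff m) hp
  rw [coeff_torus, coeff_zero] at this
  rw [coeff_zero]
  exact (mul_eq_zero.1 this).resolve_left (Units.ne_zero _)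

variable (E : Type*) [Field E] [Algebra (MvPolynomial σ K) E] [IsFractionRing (MvPolynomial σ K) E]

/-- The extension of `torus` to the field of rational functions. -/
noncomputable def torusField (φ : σ → ℤ) (s : Kˣ) : E →+* E :=
  IsFractionRing.lift (A := MvPolynomial σ K)
    (g := (algebraMap (MvPolynomial σ K) E).comp (torus φ s : MvPolynomial σ K →+* _))
    ((IsFractionRing.injective _ _).comp (torus_injective φ s))

theorem torusField_algebraMap (φ : σ → ℤ) (s : Kˣ) (p : MvPolynomial σ K) :
    torusField E φ s (algebraMap _ E p) = algebraMap _ E (torus φ s p) :=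
  IsFractionRing.lift_algebraMap _ _

variable {E} [Algebra K E]

theorem torus_monomial_one (φ : σ → ℤ) (s : Kˣ) (e : σ →₀ ℕ) :
    torus φ s (monomial e (1 : K)) =
      C ((s ^ ∑ i, φ i * e i : Kˣ) : K) * monomial e 1 := by
  classical
  ext m
  rw [coeff_torus, coeff_C_mul, coeff_monomial]
  split_ifs with h
  · rw [h]
  · rw [mul_zero, mul_zero]

/-- Each τ i sends z to a root of one fixed polynomial over F. -/
theorem finite_range_of_isAlgebraic {ι : Type*} (F : IntermediateField K E) (τ : ι → E →+* E)
    (hτ : ∀ i, ∀ y ∈ F, τ i y = y) {z : E} (hz : IsAlgebraic F z) :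
    (Set.range fun i => τ i z).Finite := by
  obtain ⟨p, hp0, hp⟩ := hz
  refine (p.rootSet_finite E).subset ?_
  rintro _ ⟨i, rfl⟩
  rw [Polynomial.mem_rootSet]
  refine ⟨hp0, ?_⟩
  have h1 : (τ i).comp (algebraMap F E) = algebraMap F E := by
    ext y
    exact hτ i y y.2
  have h2 := congrArg (τ i) hp
  rwa [Polynomial.aeval_def, Polynomial.hom_eval₂, h1, map_zero] at h2

theorem finite_setOf_zpow_eq (d : ℤ) (hd : d ≠ 0) (y : Kˣ) : {s : Kˣ | s ^ d = y}.Finite := by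
  rcases Set.eq_empty_or_nonempty {s : Kˣ | s ^ d = y} with h | ⟨s₀, hs₀⟩
  · rw [h]
    exact Set.finite_empty
  have hn : 0 < d.natAbs := Int.natAbs_pos.2 hd
  have hfin : {x : K | x ^ d.natAbs = (s₀ : K) ^ d.natAbs}.Finite :=
    ((Polynomial.X ^ d.natAbs - Polynomial.C ((s₀ : K) ^ d.natAbs)).rootSet_finite K).subset
      fun x hx => by
        rw [Polynomial.mem_rootSet]
        exact ⟨Polynomial.X_pow_sub_C_ne_zero hn _, by simpa [sub_eq_zero] using hx⟩
  refine (hfin.preimage Units.val_injective.injOn).subset fun s hs => ?_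
  have h1 : s ^ d = s₀ ^ d := Eq.trans hs (Eq.symm hs₀)
  have h2 : s ^ d.natAbs = s₀ ^ d.natAbs := by
    rcases Int.natAbs_eq d with h | h
    · rwa [h, zpow_natCast, zpow_natCast] at h1
    · rwa [h, zpow_neg, zpow_neg, zpow_natCast, zpow_natCast, inv_inj] at h1
  change (s : K) ^ d.natAbs = (s₀ : K) ^ d.natAbs
  exact_mod_cast congrArg (Units.val) h2

/-- A quotient `G / x ^ e` in which a monomial of non-zero weight occurs is transcendental over
every field fixed by the torus. -/
theorem transcendental_div_monomial [Infinite K] (φ : σ → ℤ) (F : IntermediateField K E)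
    (hF : ∀ s : Kˣ, ∀ y ∈ F, torusField E φ s y = y) {G : MvPolynomial σ K} {a e : σ →₀ ℕ}
    (ha : coeff a G ≠ 0) (hφ : ∑ i, φ i * a i ≠ ∑ i, φ i * e i) :
    Transcendental F (algebraMap _ E G / algebraMap _ E (monomial e (1 : K))) := by
  classical
  intro halg
  have hfin := finite_range_of_isAlgebraic F (torusField E φ) hF halg
  have hd : ∑ i, φ i * a i - ∑ i, φ i * e i ≠ 0 := sub_ne_zero.2 hφ
  have hmon0 : monomial e (1 : K) ≠ 0 := by
    rw [ne_eq, monomial_eq_zero]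
    exact one_ne_zero
  have hinj := IsFractionRing.injective (MvPolynomial σ K) E
  have hne {p : MvPolynomial σ K} (hp : p ≠ 0) : algebraMap _ E p ≠ 0 :=
    (map_ne_zero_iff _ hinj).2 hp
  have hCne (s : Kˣ) : C (s : K) * monomial e (1 : K) ≠ 0 :=
    mul_ne_zero (by rw [ne_eq, C_eq_zero]; exact s.ne_zero) hmon0
  -- Comparing coefficients at a, the image of the quotient under s determines s to the power d, the
  -- non-zero weight difference. A finite orbit would then leave only finitely many s.
  have hfib (s t : Kˣ) (h : torusField E φ s (algebraMap _ E G / algebraMap _ E (monomial e (1 : K)))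
      = torusField E φ t (algebraMap _ E G / algebraMap _ E (monomial e (1 : K)))) :
      s ^ (∑ i, φ i * a i - ∑ i, φ i * e i) = t ^ (∑ i, φ i * a i - ∑ i, φ i * e i) := by
    rw [map_div₀, map_div₀, torusField_algebraMap, torusField_algebraMap, torusField_algebraMap,
      torusField_algebraMap, torus_monomial_one, torus_monomial_one,
      div_eq_div_iff (hne (hCne _)) (hne (hCne _)),
      ← map_mul, ← map_mul, ← mul_assoc, ← mul_assoc] at h
    have h1 := mul_right_cancel₀ hmon0 (hinj h)
    have h2 := congrArg (coeff a) h1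
    rw [mul_comm, coeff_C_mul, mul_comm (torus φ t G), coeff_C_mul, coeff_torus, coeff_torus,
      ← mul_assoc, ← mul_assoc] at h2
    have h3 := mul_right_cancel₀ ha h2
    rw [← Units.val_mul, ← Units.val_mul, Units.val_inj] at h3
    rw [zpow_sub, zpow_sub, mul_inv_eq_iff_eq_mul, mul_assoc, mul_comm _ (s ^ _), ← mul_assoc,
      eq_mul_inv_iff_mul_eq, mul_comm, h3, mul_comm]
  have hfin' : (Set.univ : Set Kˣ).Finite := by
    refine Set.Finite.of_finite_fibers (fun s => torusField E φ s
      (algebraMap _ E G / algebraMap _ E (monomial e (1 : K)))) ?_ ?_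
    · rwa [Set.image_univ]
    · rintro _ ⟨s₀, -, rfl⟩
      refine (finite_setOf_zpow_eq _ hd (s₀ ^ (∑ i, φ i * a i - ∑ i, φ i * e i))).subset ?_
      rintro s ⟨-, hs⟩
      exact hfib s s₀ hs
  have hinfK : Infinite Kˣ := by
    rw [unitsEquivNeZero.infinite_iff]
    exact (Set.finite_singleton (0 : K)).infinite_compl.to_subtype
  exact Set.infinite_univ hfin'

variable [IsScalarTower K (MvPolynomial σ K) E]

theorem torusField_algebraMap_base (φ : σ → ℤ) (s : Kˣ) (c : K) :
    torusField E φ s (algebraMap K E c) = algebraMap K E c := by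
  rw [IsScalarTower.algebraMap_apply K (MvPolynomial σ K) E, torusField_algebraMap,
    AlgHom.commutes]

/-- Algebraic independence of `G / x ^ e` and `x ^ e' / x ^ e` when the exponents `a`, `e`, `e'`
are not collinear for some exponent `a` of `G`. -/
theorem algebraicIndependent_div_monomial [DecidableEq σ] [Infinite K] {G : MvPolynomial σ K}
    {a e e' : σ →₀ ℕ} (ha : coeff a G ≠ 0) {i j : σ}
    (hij : ((a i : ℤ) - e i) * ((e' j : ℤ) - e j) ≠ ((a j : ℤ) - e j) * ((e' i : ℤ) - e i)) :
    AlgebraicIndependent K ![algebraMap _ E G / algebraMap _ E (monomial e (1 : K)),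
      algebraMap _ E (monomial e' (1 : K)) / algebraMap _ E (monomial e (1 : K))] := by
  set v := algebraMap _ E (monomial e' (1 : K)) / algebraMap _ E (monomial e (1 : K)) with hv
  rw [algebraicIndependent_pair_iff]
  have hsum (p q : ℤ) (m : σ →₀ ℕ) :
      ∑ k, (Pi.single i p - Pi.single j q : σ → ℤ) k * m k = p * m i - q * m j := by
    simp [sub_mul, Finset.sum_sub_distrib, Pi.single_apply]
  constructor
  · have hdiff : e' i ≠ e i ∨ e' j ≠ e j := by
      by_contra! h
      rw [h.1, h.2] at hij
      simp at hij
    have key (φ : σ → ℤ) (h : ∑ i, φ i * e' i ≠ ∑ i, φ i * e i) : Transcendental K v := by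
      have hT := transcendental_div_monomial (E := E) (K := K) φ ⊥ ?_
        (G := monomial e' (1 : K)) (a := e') (by simp) h
      · exact hT.restrictScalars (algebraMap K (⊥ : IntermediateField K E)).injective
      · rintro s y hy
        obtain ⟨c, rfl⟩ := IntermediateField.mem_bot.1 hy
        exact torusField_algebraMap_base φ s c
    rcases hdiff with h | h
    · refine key (Pi.single i 1 - Pi.single j 0) ?_
      rw [hsum, hsum]
      lia
    · refine key (Pi.single i 0 - Pi.single j 1) ?_
      rw [hsum, hsum]
      lia
  -- These weights are orthogonal to e' - e, so the torus fixes K(v); they are not orthogonal to a -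
  -- e, by `hij`.
  · refine transcendental_div_monomial
      (Pi.single i ((e' j : ℤ) - e j) - Pi.single j ((e' i : ℤ) - e i)) _ ?_ ha ?_
    · intro s y hy
      have hfix : torusField E (Pi.single i ((e' j : ℤ) - e j) - Pi.single j ((e' i : ℤ) - e i)) s v
          = v := by
        rw [hv, map_div₀, torusField_algebraMap, torusField_algebraMap, torus_monomial_one,
          torus_monomial_one, hsum, hsum, map_mul, map_mul]
        have h1 : ((e' j : ℤ) - e j) * e' i - ((e' i : ℤ) - e i) * e' j =
          ((e' j : ℤ) - e j) * e i - ((e' i : ℤ) - e i) * e j := by ring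
        rw [h1]
        refine mul_div_mul_left _ _ ?_
        rw [ne_eq, map_eq_zero_iff _ (IsFractionRing.injective (MvPolynomial σ K) E), C_eq_zero]
        exact Units.ne_zero _
      obtain ⟨r, t, rfl⟩ := (mem_adjoin_simple_iff K y).1 hy
      have hcomp : (torusField E (Pi.single i ((e' j : ℤ) - e j) -
          Pi.single j ((e' i : ℤ) - e i)) s).comp (algebraMap K E) = algebraMap K E := by
        ext c
        exact torusField_algebraMap_base _ s c
      rw [map_div₀, Polynomial.aeval_def, Polynomial.aeval_def, Polynomial.hom_eval₂,
        Polynomial.hom_eval₂, hcomp, hfix]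
    · rw [hsum, hsum]
      intro h
      apply hij
      linear_combination h

end Torus

end MvPolynomial

/-! ### Monomial divisors, p-th powers, restriction to lines -/

namespace MvPolynomial

theorem X_dvd_iff_forall_ne_zero {σ R : Type*} [CommSemiring R] {i : σ} {p : MvPolynomial σ R} :
    X i ∣ p ↔ ∀ m, coeff m p ≠ 0 → m i ≠ 0 := by
  classical
  constructor
  · rintro ⟨q, rfl⟩ m hm hi
    rw [coeff_X_mul', if_neg (by simpa using hi)] at hm
    exact hm rfl
  · intro h
    rw [p.as_sum]
    exact Finset.dvd_sum fun m hm => X_dvd_monomial.2 (Or.inr (h m (mem_support_iff.1 hm)))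

theorem exists_associated_X_of_prime_dvd_monomial {σ K : Type*} [Field K] {D : MvPolynomial σ K}
    (hD : Prime D) {e : σ →₀ ℕ} (h : D ∣ monomial e (1 : K)) : ∃ i, Associated D (X i) := by
  rw [monomial_eq, C_1, one_mul, Finsupp.prod] at h
  obtain ⟨i, -, hi⟩ := hD.exists_mem_finset_dvd h
  exact ⟨i, hD.associated_of_dvd X_prime (hD.dvd_of_dvd_pow hi)⟩

/-- Divide the exponents by p, take p-th roots of the coefficients in K, and use additivity of
Frobenius. -/
theorem exists_eq_pow_of_forall_dvd {σ K : Type*} [Field K] [IsAlgClosed K] {p : ℕ} [Fact p.Prime]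
    [CharP K p] (P : MvPolynomial σ K) (h : ∀ m ∈ P.support, ∀ i, p ∣ m i) :
    ∃ S : MvPolynomial σ K, P = S ^ p := by
  have hp : 0 < p := (Fact.out : p.Prime).pos
  choose r hr using fun c : K => IsAlgClosed.exists_pow_nat_eq c hp
  refine ⟨∑ m ∈ P.support, monomial (m.mapRange (· / p) (Nat.zero_div p)) (r (coeff m P)), ?_⟩
  rw [sum_pow_char]
  conv_lhs => rw [P.as_sum]
  refine Finset.sum_congr rfl fun m hm => ?_
  have hm' : p • m.mapRange (· / p) (Nat.zero_div p) = m := by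
    ext i
    simp [Nat.mul_div_cancel' (h m hm i)]
  rw [monomial_pow, hr, hm']

/-- Restriction of a polynomial to a line parallel to a coordinate axis. -/
theorem exists_polynomial_eval_update {τ K : Type*} [DecidableEq τ] [Field K] (g : MvPolynomial τ K)
    (s : τ → K) (i : τ) (hg : eval s g ≠ 0) : ∃ h : Polynomial K, h ≠ 0 ∧
      ∀ c, h.eval c = eval (Function.update s i (s i + c)) g := by
  let h : Polynomial K := aeval (fun j => Polynomial.C (s j) + if j = i then Polynomial.X else 0) g
  have heval (c : K) : h.eval c = eval (Function.update s i (s i + c)) g := by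
    have : (Polynomial.evalRingHom c).comp (aeval (fun j => Polynomial.C (s j) +
        if j = i then Polynomial.X else 0) : MvPolynomial τ K →ₐ[K] Polynomial K).toRingHom =
        eval (Function.update s i (s i + c)) := by
      refine ringHom_ext (fun a => by simp) fun j => ?_
      by_cases hj : j = i
      · subst hj
        simp
      · simp [hj]
    exact RingHom.congr_fun this g
  refine ⟨h, fun h0 => hg ?_, heval⟩
  have := heval 0
  rw [h0, Polynomial.eval_zero, add_zero, Function.update_eq_self] at this
  exact this.symm

end MvPolynomial

/-! ### The linear family and its good parameters -/

open MvPolynomial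

section Family

variable {K : Type*} [Field K] {n ℓ : ℕ} {P : MvPolynomial (Fin n) K}
  {Q : Fin ℓ → MvPolynomial (Fin n) K}

theorem specialMember_update (t : Fin ℓ → K) (i : Fin ℓ) (c : K) :
    specialMember P Q (Function.update t i (t i + c)) = specialMember P Q t + C c * Q i := by
  have : ∑ j, C (Function.update t i (t i + c) j) * Q j =
      ∑ j, (C (t j) * Q j + if j = i then C c * Q i else 0) := by
    refine Finset.sum_congr rfl fun j _ => ?_
    by_cases hj : j = i
    · subst hj
      simp [add_mul]
    · simp [hj]
  rw [specialMember, specialMember, this, Finset.sum_add_distrib]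
  simp [add_assoc]

/-- The exponents of the monomials that occur in `P` or among the `Qᵢ`. -/
def familyExponents (P : MvPolynomial (Fin n) K) (e : Fin ℓ → Fin n →₀ ℕ) : Set (Fin n →₀ ℕ) :=
  {m | coeff m P ≠ 0} ∪ Set.range e

/-- As the eᵢ are distinct, the coefficient at eᵢ is exactly tᵢ plus that of P; the other
coefficients of P are untouched. -/
theorem coeff_specialMember_ne_zero {e : Fin ℓ → Fin n →₀ ℕ} (hQ : ∀ i, Q i = monomial (e i) 1)
    (he : Function.Injective e) {t : Fin ℓ → K} (ht : ∀ i, t i + coeff (e i) P ≠ 0)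
    {m : Fin n →₀ ℕ} (hm : m ∈ familyExponents P e) : coeff m (specialMember P Q t) ≠ 0 := by
  classical
  have h : coeff m (specialMember P Q t) = coeff m P + ∑ i, if e i = m then t i else 0 := by
    simp [specialMember, coeff_sum, hQ, coeff_C_mul, coeff_monomial]
  rw [h]
  by_cases hme : ∃ i, e i = m
  · obtain ⟨i, rfl⟩ := hme
    simp only [he.eq_iff, Finset.sum_ite_eq', Finset.mem_univ, if_true]
    rw [add_comm]
    exact ht i
  · push Not at hme
    rw [Finset.sum_eq_zero fun i _ => if_neg (hme i), add_zero]
    exact hm.resolve_right fun ⟨i, hi⟩ => hme i hi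

/-- A prime divisor of Q i is a variable up to a unit. If it divides the member, it divides every
monomial of the family, so P and all the Q k. -/
theorem isRelPrime_specialMember {e : Fin ℓ → Fin n →₀ ℕ} (hQ : ∀ i, Q i = monomial (e i) 1)
    (he : Function.Injective e) (hcop : AreRelativelyPrime P Q)
    {t : Fin ℓ → K} (ht : ∀ i, t i + coeff (e i) P ≠ 0) (i : Fin ℓ) :
    IsRelPrime (Q i) (specialMember P Q t) := by
  have hQ0 : Q i ≠ 0 := by
    rw [hQ, ne_eq, monomial_eq_zero]
    exact one_ne_zero
  refine WfDvdMonoid.isRelPrime_of_no_irreducible_factors (fun h => hQ0 h.1)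
    fun D hD hDQ hDP => ?_
  rw [hQ] at hDQ
  obtain ⟨j, hj⟩ := exists_associated_X_of_prime_dvd_monomial hD.prime hDQ
  rw [hj.dvd_iff_dvd_left, X_dvd_iff_forall_ne_zero] at hDP
  have hall (m : Fin n →₀ ℕ) (hm : m ∈ familyExponents P e) : m j ≠ 0 :=
    hDP m (coeff_specialMember_ne_zero hQ he ht hm)
  refine (X_prime (R := K) (i := j)).not_isUnit (hcop _ ?_ fun k => ?_)
  · exact X_dvd_iff_forall_ne_zero.2 fun m hm => hall m (Or.inl hm)
  · rw [hQ, X_dvd_monomial]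
    exact Or.inr (hall _ (Or.inr ⟨k, rfl⟩))

/-- If all these 2 × 2 minors vanished, every exponent would lie on the line through e k and e k'.
-/
theorem exists_mem_familyExponents_not_collinear {e : Fin ℓ → Fin n →₀ ℕ}
    (hQ : ∀ i, Q i = monomial (e i) 1)
    (hline : ¬ Collinear ℚ (newtonPoints P ∪ ⋃ i, newtonPoints (Q i))) {k k' : Fin ℓ}
    (hk : e k ≠ e k') : ∃ a ∈ familyExponents P e, ∃ i j,
      ((a i : ℤ) - e k i) * ((e k' j : ℤ) - e k j) ≠
        ((a j : ℤ) - e k j) * ((e k' i : ℤ) - e k i) := by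
  classical
  by_contra! hall
  apply hline
  have hmem (v : Fin n → ℚ) (hv : v ∈ newtonPoints P ∪ ⋃ i, newtonPoints (Q i)) :
      ∃ a ∈ familyExponents P e, v = fun j => (a j : ℚ) := by
    rcases hv with ⟨a, ha, rfl⟩ | hv
    · exact ⟨a, Or.inl (mem_support_iff.1 ha), rfl⟩
    · obtain ⟨i, a, ha, rfl⟩ := Set.mem_iUnion.1 hv
      refine ⟨a, Or.inr ⟨i, ?_⟩, rfl⟩
      rw [hQ, mem_support_iff, coeff_monomial] at ha
      by_contra h
      exact ha (if_neg h)
  have hk0 : (fun j => (e k j : ℚ)) ∈ newtonPoints P ∪ ⋃ i, newtonPoints (Q i) := by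
    refine Or.inr (Set.mem_iUnion.2 ⟨k, e k, ?_, rfl⟩)
    rw [hQ, mem_support_iff, coeff_monomial, if_pos rfl]
    exact one_ne_zero
  rw [collinear_iff_of_mem hk0]
  refine ⟨fun j => (e k' j : ℚ) - e k j, fun v hv => ?_⟩
  obtain ⟨a, ha, rfl⟩ := hmem v hv
  obtain ⟨j, hj⟩ : ∃ j, e k' j ≠ e k j := by
    by_contra! h
    exact hk (Finsupp.ext h).symm
  have hj' : (e k' j : ℚ) - e k j ≠ 0 := by
    rw [sub_ne_zero]
    exact_mod_cast hj
  refine ⟨((a j : ℚ) - e k j) / ((e k' j : ℚ) - e k j), ?_⟩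
  ext i
  have h : ((a i : ℚ) - e k i) * ((e k' j : ℚ) - e k j) =
      ((a j : ℚ) - e k j) * ((e k' i : ℚ) - e k i) := by
    exact_mod_cast hall a ha i j
  simp only [vadd_eq_add, Pi.add_apply, Pi.smul_apply, smul_eq_mul]
  rw [div_mul_eq_mul_div, ← h, mul_div_cancel_right₀ _ hj']
  ring

theorem exists_mem_familyExponents_cast_ne_zero [IsAlgClosed K] {e : Fin ℓ → Fin n →₀ ℕ}
    (hQ : ∀ i, Q i = monomial (e i) 1) (hP : 0 < P.totalDegree)
    (hpow : ∀ p : ℕ, p.Prime → CharP K p →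
      (¬ ∃ S : MvPolynomial (Fin n) K, P = S ^ p) ∨
        ∃ i, ¬ ∃ S : MvPolynomial (Fin n) K, Q i = S ^ p) :
    ∃ m ∈ familyExponents P e, ∃ i, (m i : K) ≠ 0 := by
  classical
  by_contra! hall
  rcases CharP.exists' K with h0 | ⟨p, hp, hchar⟩
  · have : P.totalDegree = 0 := by
      rw [← Nat.le_zero]
      refine Finset.sup_le fun m hm => ?_
      have hm0 : m = 0 := by
        ext i
        exact_mod_cast hall m (Or.inl (mem_support_iff.1 hm)) i
      rw [hm0]
      simp
    lia
  · have hdvd (m : Fin n →₀ ℕ) (hm : m ∈ familyExponents P e) (i : Fin n) : p ∣ m i :=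
      (CharP.cast_eq_zero_iff K p _).1 (hall m hm i)
    rcases hpow p hp.out hchar with h | ⟨i, h⟩
    · exact h (exists_eq_pow_of_forall_dvd P fun m hm => hdvd m (Or.inl (mem_support_iff.1 hm)))
    · refine h (exists_eq_pow_of_forall_dvd (Q i) fun m hm => hdvd m (Or.inr ⟨i, ?_⟩))
      rw [hQ, mem_support_iff, coeff_monomial] at hm
      by_contra h
      exact hm (if_neg h)

/-- The member with generic coefficients, over the polynomial ring in the parameters. -/
noncomputable def universalMember (P : MvPolynomial (Fin n) K)
    (Q : Fin ℓ → MvPolynomial (Fin n) K) : MvPolynomial (Fin n) (MvPolynomial (Fin ℓ) K) :=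
  map C P + ∑ i, C (X i) * map C (Q i)

theorem map_eval_universalMember (t : Fin ℓ → K) :
    map (eval t) (universalMember P Q) = specialMember P Q t := by
  have h : (eval t).comp C = RingHom.id K := RingHom.ext fun x => eval_C x
  simp [universalMember, specialMember, map_map, h, map_id]

theorem map_algebraMap_universalMember :
    map (algebraMap (MvPolynomial (Fin ℓ) K) (GenericField K ℓ)) (universalMember P Q) =
      genericMember P Q := by
  have h : (algebraMap (MvPolynomial (Fin ℓ) K) (GenericField K ℓ)).comp C = genericConst K ℓ := by
    rw [genericConst, ← RingHom.comp_assoc, ← IsScalarTower.algebraMap_eq]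
  have hX (i : Fin ℓ) : algebraMap (MvPolynomial (Fin ℓ) K) (GenericField K ℓ) (X i) =
      genericParam K i := by
    rw [genericParam, ← IsScalarTower.algebraMap_apply]
  simp [universalMember, genericMember, map_map, h, hX]

end Family

/-! ### Density of irreducible members, and the theorem -/

/-- Every dense open subset of the parameter space contains the parameter of an irreducible
member. -/
theorem exists_eval_ne_zero_irreducible_specialMember {K : Type*} [Field K] [IsAlgClosed K]
    {n ℓ : ℕ} (hℓ : 2 ≤ ℓ) (P : MvPolynomial (Fin n) K) (hP : 0 < P.totalDegree)
    (Q : Fin ℓ → MvPolynomial (Fin n) K) {e : Fin ℓ → Fin n →₀ ℕ}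
    (hQ : ∀ i, Q i = monomial (e i) 1) (he : Function.Injective e)
    (hcop : AreRelativelyPrime P Q)
    (hline : ¬ Collinear ℚ (newtonPoints P ∪ ⋃ i, newtonPoints (Q i)))
    (hpow : ∀ p : ℕ, p.Prime → CharP K p →
      (¬ ∃ S : MvPolynomial (Fin n) K, P = S ^ p) ∨
        ∃ i, ¬ ∃ S : MvPolynomial (Fin n) K, Q i = S ^ p)
    (f : MvPolynomial (Fin ℓ) K) (hf : f ≠ 0) :
    ∃ t : Fin ℓ → K, eval t f ≠ 0 ∧ Irreducible (specialMember P Q t) := by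
  classical
  have hinf : Infinite K := IsAlgClosed.instInfinite
  let i₀ : Fin ℓ := ⟨0, by lia⟩
  let i₁ : Fin ℓ := ⟨1, by lia⟩
  have hi : i₀ ≠ i₁ := by simp [i₀, i₁]
  obtain ⟨a, ha, i, j, hij⟩ :=
    exists_mem_familyExponents_not_collinear hQ hline (k := i₀) (k' := i₁) (he.ne hi)
  obtain ⟨m, hm, r, hmr⟩ := exists_mem_familyExponents_cast_ne_zero hQ hP hpow
  -- Non-vanishing of g encodes both f ≠ 0 and goodness of the parameter.
  let g : MvPolynomial (Fin ℓ) K := f * ∏ i, (X i + C (coeff (e i) P))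
  have hg0 : g ≠ 0 := by
    refine mul_ne_zero hf (Finset.prod_ne_zero_iff.2 fun i _ h => ?_)
    have := congrArg (coeff (Finsupp.single i 1)) h
    rw [coeff_add, coeff_X, if_pos rfl, coeff_C,
      if_neg (Finsupp.single_ne_zero.2 one_ne_zero).symm, add_zero, coeff_zero] at this
    exact one_ne_zero this
  have hgood {t : Fin ℓ → K} (ht : eval t g ≠ 0) :
      eval t f ≠ 0 ∧ ∀ i, t i + coeff (e i) P ≠ 0 := by
    rw [map_mul, map_prod] at ht
    refine ⟨left_ne_zero_of_mul ht, fun i => ?_⟩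
    simpa using Finset.prod_ne_zero_iff.1 (right_ne_zero_of_mul ht) i (Finset.mem_univ i)
  obtain ⟨s, hs⟩ : ∃ s, eval s g ≠ 0 := by
    by_contra! h
    exact hg0 (MvPolynomial.funext fun s => by rw [h s, map_zero])
  let E := FractionRing (MvPolynomial (Fin n) K)
  let u : E := algebraMap _ E (specialMember P Q s) / algebraMap _ E (Q i₀)
  let v : E := algebraMap _ E (Q i₁) / algebraMap _ E (Q i₀)
  have hind : AlgebraicIndependent K ![u, v] := by
    have := algebraicIndependent_div_monomial (E := E)
      (coeff_specialMember_ne_zero hQ he (hgood hs).2 ha) hij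
    rwa [← hQ, ← hQ] at this
  have : Algebra.EssFiniteType K E := .comp K (MvPolynomial (Fin n) K) E
  have hbad := finite_setOf_exists_isSeparable_notMem hind
  -- Replacing u by u + cv moves s along the i₁ axis; c avoids the bad values of Zariski–Matsusaka
  -- and the zeros of g on that line.
  obtain ⟨h₁, hh₁, hh₁e⟩ := exists_polynomial_eval_update g s i₁ hs
  obtain ⟨c, hc⟩ := (hbad.union (h₁.rootSet_finite K)).infinite_compl.nonempty
  rw [Set.mem_compl_iff, Set.mem_union, not_or, Polynomial.mem_rootSet, not_and] at hc
  obtain ⟨hc₁, hc₂⟩ := hc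
  have hgc := hc₂ hh₁
  rw [Polynomial.coe_aeval_eq_eval, hh₁e] at hgc
  set s' := Function.update s i₁ (s i₁ + c) with hs'
  have hQ0 : Q i₀ ≠ 0 := by
    rw [hQ, ne_eq, monomial_eq_zero]
    exact one_ne_zero
  have hw : u + c • v = algebraMap _ E (specialMember P Q s') / algebraMap _ E (Q i₀) := by
    rw [hs', specialMember_update, map_add, map_mul, add_div, Algebra.smul_def, mul_div_assoc,
      IsScalarTower.algebraMap_apply K (MvPolynomial (Fin n) K) E]
    rfl
  have htr : Transcendental K (u + c • v) := by
    have hv := algebraicIndependent_pair_iff.1 hind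
    intro halg
    refine hv.2 ?_
    have h1 : IsAlgebraic (IntermediateField.adjoin K {v}) (u + c • v) := halg.tower_top _
    have h2 : IsAlgebraic (IntermediateField.adjoin K {v}) (c • v) :=
      isAlgebraic_algebraMap (⟨c • v, IntermediateField.smul_mem _
        (IntermediateField.mem_adjoin_simple_self K v)⟩ : IntermediateField.adjoin K {v})
    simpa using h1.sub h2
  obtain ⟨q, hq0, hq⟩ := exists_ne_zero_forall_irreducible_sub_C_mul hQ0
    (isRelPrime_specialMember hQ he hcop (hgood hgc).2 i₀) hw htr
    (fun θ hθ => by_contra fun h => hc₁ ⟨θ, hθ, h⟩) hmr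
    (Or.inl (coeff_specialMember_ne_zero hQ he (hgood hgc).2 hm))
  -- The pencil parameter moves s' along the i₀ axis. Moving by d adds d * Q i₀, which is the pencil
  -- at t = -d, whence the composition of q with -X.
  obtain ⟨h₀, hh₀, hh₀e⟩ := exists_polynomial_eval_update g s' i₀ hgc
  obtain ⟨d, hd⟩ := ((q.comp (-Polynomial.X) * h₀).rootSet_finite K).infinite_compl.nonempty
  have hqc : q.comp (-Polynomial.X) ≠ 0 := by
    rwa [ne_eq, Polynomial.comp_neg_X_eq_zero_iff]
  rw [Set.mem_compl_iff, Polynomial.mem_rootSet, not_and, Polynomial.coe_aeval_eq_eval,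
    Polynomial.eval_mul, hh₀e, Polynomial.eval_comp] at hd
  have hd' := hd (mul_ne_zero hqc hh₀)
  refine ⟨_, (hgood (right_ne_zero_of_mul hd')).1, ?_⟩
  rw [specialMember_update]
  have := hq (-d) (by simpa using left_ne_zero_of_mul hd')
  simpa using this

theorem theorem1p3 {K : Type*} [Field K] [IsAlgClosed K] {n ℓ : ℕ} (hℓ : 2 ≤ ℓ)
    (P : MvPolynomial (Fin n) K) (hP : 0 < P.totalDegree)
    (Q : Fin ℓ → MvPolynomial (Fin n) K)
    (hQ : ∀ i, IsMonicMonomial (Q i)) (hQ_inj : Function.Injective Q)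
    (hdeg : ∀ i, (Q i).totalDegree ≤ P.totalDegree)
    (hcop : AreRelativelyPrime P Q)
    (hline : ¬ Collinear ℚ (newtonPoints P ∪ ⋃ i, newtonPoints (Q i)))
    (hpow : ∀ p : ℕ, p.Prime → CharP K p →
      (¬ ∃ S : MvPolynomial (Fin n) K, P = S ^ p) ∨
        ∃ i, ¬ ∃ S : MvPolynomial (Fin n) K, Q i = S ^ p) :
    GenericallyIrreducible P Q ∧
      ∃ U : Set (Fin ℓ → K), IsZariskiOpen U ∧ U.Nonempty ∧
        ∀ t ∈ U, Irreducible (specialMember P Q t) := by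
  classical
  choose e he using hQ
  have he_inj : Function.Injective e := fun i j h => hQ_inj (by rw [he, he, h])
  have hdense := exists_eval_ne_zero_irreducible_specialMember hℓ P hP Q he he_inj hcop hline hpow
  have hinf : Infinite K := IsAlgClosed.instInfinite
  have hinj : Function.Injective (algebraMap (MvPolynomial (Fin ℓ) K) (GenericField K ℓ)) := by
    rw [IsScalarTower.algebraMap_eq _ (FractionRing (MvPolynomial (Fin ℓ) K))]
    exact (FaithfulSMul.algebraMap_injective (FractionRing (MvPolynomial (Fin ℓ) K)) _).comp
      (IsFractionRing.injective _ _)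
  have : Algebra.IsAlgebraic (MvPolynomial (Fin ℓ) K) (GenericField K ℓ) :=
    have := IsLocalization.isAlgebraic (FractionRing (MvPolynomial (Fin ℓ) K))
      (nonZeroDivisors (MvPolynomial (Fin ℓ) K))
    Algebra.IsAlgebraic.trans _ (FractionRing (MvPolynomial (Fin ℓ) K)) _
  have hF : (universalMember P Q).totalDegree ≠ 0 := by
    intro h0
    -- A universal member of degree 0 would have no irreducible specialization, whereas density
    -- provides one.
    obtain ⟨t, -, ht⟩ := hdense 1 one_ne_zero
    have h1 := totalDegree_map_le' (eval t) (universalMember P Q)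
    rw [map_eval_universalMember, h0, Nat.le_zero,
      ← isUnit_iff_totalDegree_eq_zero ht.ne_zero] at h1
    exact ht.not_isUnit h1
  have hgen : Irreducible (map (algebraMap (MvPolynomial (Fin ℓ) K) (GenericField K ℓ))
      (universalMember P Q)) := by
    by_contra h
    obtain ⟨f, hf, H⟩ := exists_ne_zero_forall_not_irreducible_map hinj _ hF h
    obtain ⟨t, ht, hirr⟩ := hdense f hf
    exact H t ht (by rwa [map_eval_universalMember])
  refine ⟨by rwa [GenericallyIrreducible, ← map_algebraMap_universalMember], ?_⟩
  obtain ⟨f, hf, H⟩ := exists_ne_zero_forall_irreducible_map _ hinj _ hgen K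
  refine ⟨{t | eval t f ≠ 0}, ⟨{f}, ?_⟩, ?_, fun t ht => ?_⟩
  · ext t
    simp
  · obtain ⟨t, ht, -⟩ := hdense f hf
    exact ⟨t, ht⟩
  · rw [← map_eval_universalMember]
    exact H (eval t) ht
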